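/- Let $m\ge 1$, let $0<k_1<\cdots<k_m<d$ be integers with $\gcd(k_1,\dots,k_m,d)=1$, and let $A$ be the $2\times(m+2)$ matrix with rows $(1,1,\dots,1,1)$ and $(0,k_1,\dots,k_m,d)$; index $(m+2)$-tuples by $0,k_1,\dots,k_m,d$. For $\alpha\in\mathbb Z^2$, a holomorphic function $\varphi$ on an open set of $\mathbb C^{m+2}$ is called $A$-hypergeometric with exponent $\alpha$ if $$\prod_{v_j>0}\Bigl(\frac{\partial}{\partial x_j}\Bigr)^{v_j}\varphi=\prod_{v_j<0}\Bigl(\frac{\partial}{\partial x_j}\Bigr)^{-v_j}\varphi\quad\text{for all } v\in\mathbb Z^{m+2}\text{ with }Av=0,$$ $$\sum_j x_j\frac{\partial\varphi}{\partial x_j}=\alpha_1\varphi,\qquad \sum_j j\,x_j\frac{\partial\varphi}{\partial x_j}=\alpha_2\varphi .$$ Put $\Phi^A(\alpha;x)=\sum_{u\in\mathbb N^{m+2},\,Au=\alpha}\frac{x^u}{u!}$ and $I(A)=A\cdot\mathbb N^{m+2}$. Let $f(x;t)=x_0+x_{k_1}t^{k_1}+\cdots+x_{k_m}t^{k_m}+x_dt^d$,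 let $\Delta(f)$ be its discriminant with respect to $t$, and let $\mathcal U$ be a (non-empty) simply connected open subset of $\{x\in\mathbb C^{m+2}: x_0\ne0,\ x_d\neq 0,\ \Delta(f)(x)\ne0\}$. A root of $f$ on $\mathcal U$ is a holomorphic function $\rho$ on $\mathcal U$ with $f(x;\rho(x))=0$ for all $x\in\mathcal U$. **Theorem 3.1.** Let $\alpha=(\alpha_1,\alpha_2)\in I(A)$. There are exactly $d$ roots of $f$ on $\mathcal U$. Fix one of them, $\hat\rho$. For every root $\rho$ of $f$ on $\mathcal U$ there is a holomorphic branch of $\log(\rho/\hat\rho)$ on $\mathcal U$; for every $\rho\ne\hat\rho$ choose any such branch and set $$\tau_\rho(\alpha)=\sum_{\substack{0\le i\le d\alpha_1\\ i\ne\alpha_2}}\Phi^A((\alpha_1,i);x)\,\frac{\rho^{\,i-\alpha_2}-\hat\rho^{\,i-\alpha_2}}{i-\alpha_2}+\Phi^A(\alpha;x)\,\log(\rho/\hat\rho).$$ Then $\Phi^A(\alpha)$ and the $d-1$ functions $\tau_\rho(\alpha)$, where $\rho$ runs over the roots of $f$ on $\mathcal U$ different from $\hat\rho$, are $A$-hypergeometric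 functions on $\mathcal U$ with exponent $\alpha$, and these $d$ functions are linearly independent over $\mathbb C$. -/

import Mathlib

namespace MonomialCurve

/-- The integer matrix with rows `(1, …, 1)` and `(a 0, …, a (n-1))`. -/
def curveMatrix {n : ℕ} (a : Fin n → ℕ) : Matrix (Fin 2) (Fin n) ℤ :=
  Matrix.of ![fun _ => 1, fun j => (a j : ℤ)]

/-- The vector `A · u ∈ ℤ²` for `u ∈ ℕⁿ`. -/
def apply {n : ℕ} (A : Matrix (Fin 2) (Fin n) ℤ) (u : Fin n → ℕ) : Fin 2 → ℤ :=
  A.mulVec (fun j => (u j : ℤ))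

/-- The set `I(A) = A · ℕⁿ`. -/
def semigroupSet {n : ℕ} (A : Matrix (Fin 2) (Fin n) ℤ) : Set (Fin 2 → ℤ) :=
  Set.range (apply A)

/-- The hypergeometric polynomial: the sum of `x^u / u!` over all `u ∈ ℕⁿ` with `A · u = α`.
For the matrix of a monomial curve there are only finitely many such `u`, see
`finite_setOf_apply_eq`. -/
noncomputable def hyperPoly {n : ℕ} (A : Matrix (Fin 2) (Fin n) ℤ) (α : Fin 2 → ℤ)
    (x : Fin n → ℂ) : ℂ :=
  ∑ᶠ u ∈ {u : Fin n → ℕ | apply A u = α}, ∏ j, x j ^ u j / ((u j).factorial : ℂ)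

theorem finite_setOf_apply_eq {n : ℕ} (a : Fin n → ℕ) (α : Fin 2 → ℤ) :
    {u : Fin n → ℕ | apply (curveMatrix a) u = α}.Finite := by
  refine (Set.finite_Iic (fun _ : Fin n => (α 0).toNat)).subset ?_
  intro u hu j
  have h0 : ∑ i, (u i : ℤ) = α 0 := by
    have := congrFun hu 0
    simpa [apply, curveMatrix, Matrix.mulVec, dotProduct] using this
  have h1 : (u j : ℤ) ≤ ∑ i, (u i : ℤ) :=
    Finset.single_le_sum (f := fun i => (u i : ℤ)) (fun i _ => Int.natCast_nonneg _)
      (Finset.mem_univ j)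
  show u j ≤ (α 0).toNat
  omega

/-! ### The hypergeometric system on an open set -/

/-- Extension by zero of a function on `U`. Differentiability and derivatives on an open set `U`
do not depend on the values outside `U`. -/
noncomputable def zeroExt {n : ℕ} {U : Set (Fin n → ℂ)} (g : U → ℂ) : (Fin n → ℂ) → ℂ :=
  Function.extend Subtype.val g 0

/-- `g : U → ℂ` is holomorphic on (the open set) `U`. -/
def IsHolomorphic {n : ℕ} {U : Set (Fin n → ℂ)} (g : U → ℂ) : Prop :=
  DifferentiableOn ℂ (zeroExt g) U

/-- The partial derivative `∂/∂x_j`. -/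
noncomputable def partialDeriv {n : ℕ} (j : Fin n) (F : (Fin n → ℂ) → ℂ) : (Fin n → ℂ) → ℂ :=
  fun x => fderiv ℂ F x (Pi.single j 1)

/-- The operator `D_u = ∏_j (∂/∂x_j)^{u_j}`. -/
noncomputable def monomialDeriv {n : ℕ} (u : Fin n → ℕ) (F : (Fin n → ℂ) → ℂ) :
    (Fin n → ℂ) → ℂ :=
  (List.finRange n).foldr (fun j G => (partialDeriv j)^[u j] G) F

/-- `g` is a holomorphic solution on `U` of the `A`-hypergeometric system with exponent `α`:
it satisfies the equations `∏_{v_j > 0} ∂_j^{v_j} g = ∏_{v_j < 0} ∂_j^{-v_j} g` for all integer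
vectors `v` with `A v = 0`, and the homogeneity equations `∑_j A_{ij} x_j ∂_j g = α_i g`. -/
def IsHypergeometric {n : ℕ} (A : Matrix (Fin 2) (Fin n) ℤ) (α : Fin 2 → ℤ)
    {U : Set (Fin n → ℂ)} (g : U → ℂ) : Prop :=
  IsHolomorphic g ∧
  (∀ v : Fin n → ℤ, A.mulVec v = 0 → ∀ x ∈ U,
    monomialDeriv (fun j => (v j).toNat) (zeroExt g) x =
      monomialDeriv (fun j => (-v j).toNat) (zeroExt g) x) ∧
  (∀ i : Fin 2, ∀ x ∈ U,
    ∑ j, (A i j : ℂ) * x j * partialDeriv j (zeroExt g) x = (α i : ℂ) * zeroExt g x)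

/-! ### The generic polynomial with given exponents, its singular locus and its roots -/

/-- The polynomial `f(x; t) = ∑_j x_j t^{a_j}`. -/
noncomputable def genericPoly {n : ℕ} (a : Fin n → ℕ) (x : Fin n → ℂ) : Polynomial ℂ :=
  ∑ j, Polynomial.C (x j) * Polynomial.X ^ a j

/-- The locus where the first coefficient, the last coefficient or the discriminant of
`f(x; t)` vanishes. -/
def singularLocus {m : ℕ} (a : Fin (m + 2) → ℕ) : Set (Fin (m + 2) → ℂ) :=
  {x | x 0 = 0 ∨ x (Fin.last (m + 1)) = 0 ∨ (genericPoly a x).discr = 0}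

/-- The set of all roots of `f(x; t)` on `U`, i.e. of all holomorphic functions `ρ` on `U` with
`f(x; ρ(x)) = 0`. -/
def rootsOn {n : ℕ} (a : Fin n → ℕ) (U : Set (Fin n → ℂ)) : Set (U → ℂ) :=
  {ρ | IsHolomorphic ρ ∧ ∀ x : U, (genericPoly a (x : Fin n → ℂ)).eval (ρ x) = 0}

/-- `l` is a holomorphic branch on `U` of `log g`. -/
def IsLogBranch {n : ℕ} {U : Set (Fin n → ℂ)} (l g : U → ℂ) : Prop :=
  IsHolomorphic l ∧ ∀ x, Complex.exp (l x) = g x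

/-- The function `τ_ρ(α)` attached to the roots `ρ`, `ρ'` and the branch `l` of `log (ρ / ρ')`. -/
noncomputable def tau {m : ℕ} (a : Fin (m + 2) → ℕ) (α : Fin 2 → ℤ)
    {U : Set (Fin (m + 2) → ℂ)} (ρ ρ' l : U → ℂ) : U → ℂ := fun x =>
  (∑ i ∈ (Finset.Icc (0 : ℤ) ((a (Fin.last (m + 1)) : ℤ) * α 0)).erase (α 1),
    hyperPoly (curveMatrix a) ![α 0, i] x *
      ((ρ x ^ (i - α 1) - ρ' x ^ (i - α 1)) / ((i : ℂ) - (α 1 : ℂ)))) +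
  hyperPoly (curveMatrix a) α x * l x

/-- The family consisting of `Φ^A(α)` (at `none`) and of the `τ_ρ(α)` for all roots `ρ` on `U`
different from `ρ'`; `l ρ` is the branch of `log (ρ / ρ')` used in `τ_ρ(α)`. -/
noncomputable def solutionFamily {m : ℕ} (a : Fin (m + 2) → ℕ) (α : Fin 2 → ℤ)
    {U : Set (Fin (m + 2) → ℂ)} (ρ' : rootsOn a U)
    (l : {ρ : rootsOn a U // ρ ≠ ρ'} → U → ℂ) :
    Option {ρ : rootsOn a U // ρ ≠ ρ'} → U → ℂ
  | none => fun x => hyperPoly (curveMatrix a) α x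
  | some ρ => tau a α (ρ : rootsOn a U) ρ' (l ρ)

end MonomialCurve

/-! For two roots ρ, ρ̂ put P_p = (ρ^p - ρ̂^p)/p, and P_0 = log(ρ/ρ̂). Grouping monomials by the
value of a·u turns τ_ρ(k, s) into the sum of x^u/u! · P_{a·u - s} over |u| = k (`tau_eq_tauSum`).
The logarithm needs no separate treatment, because dP_p = ρ^{p-1} dρ - ρ̂^{p-1} dρ̂ for every p,
including 0.

Hypergeometric equations: when ∂_j falls on the factors P, the total is a combination of f(ρ)^k/k!
and f(ρ̂)^k/k!, by the multinomial theorem (`hyperSum_pow`), and vanishes for k ≥ 1. When it falls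
on the monomials it shifts (k, s) to (k - 1, s - a_j). At k = 0 one has ∂_j P_p = ∂_0 P_{p + a_j},
so the family extends to negative k and forms a ladder (`isLadder_tauLadder`). On a ladder D_u
depends only on A·u, which gives the toric equations. The Euler equations come from f(ρ) = 0 and
from Σ a_j x_j ρ^{a_j} = ρ f'(ρ).

Independence: applying D_w with A·w = α moves a linear relation to exponent (0, 0). Since the gcd is
1, for d consecutive integers N there is u of one common size K + 1 with a·u = N. Applying D_u shows
that ∂_0^{K+1} kills the combination at exponent (0, -N), so the weighted power sums Σ c_σ σ^N, with
total weight zero, are polynomials in x_0 along a line. Interpolating with the divided difference of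
f forces all weights to agree (`weights_eq_of_powerSums_eq`), hence to vanish. Only the constant
Φ(0, 0) = 1 is then left.

The roots themselves are lifts of the identity of U to the incidence variety, a covering of U with d
sheets (`isCoveringMap_rootProj`). -/

open Polynomial Filter Topology
open scoped ContDiff

namespace MonomialCurve

/-! ### Simple, nonzero roots away from the singular locus -/

section GenericPolynomial

variable {n m : ℕ}

theorem eval_genericPoly (a : Fin n → ℕ) (x : Fin n → ℂ) (t : ℂ) :
    (genericPoly a x).eval t = ∑ j, x j * t ^ a j := by
  simp [genericPoly, eval_finsetSum]

theorem eval_derivative_genericPoly (a : Fin n → ℕ) (x : Fin n → ℂ) (t : ℂ) :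
    (genericPoly a x).derivative.eval t = ∑ j, x j * (a j * t ^ (a j - 1)) := by
  simp [genericPoly, eval_finsetSum, derivative_X_pow]

theorem coeff_genericPoly {a : Fin n → ℕ} (ha : StrictMono a) (x : Fin n → ℂ) (i : Fin n) :
    (genericPoly a x).coeff (a i) = x i := by
  simp [genericPoly, coeff_X_pow, ha.injective.eq_iff]

theorem natDegree_genericPoly {a : Fin (m + 2) → ℕ} (ha : StrictMono a) {x : Fin (m + 2) → ℂ}
    (hx : x (Fin.last (m + 1)) ≠ 0) : (genericPoly a x).natDegree = a (Fin.last (m + 1)) := by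
  refine le_antisymm ?_ (le_natDegree_of_ne_zero (by rwa [coeff_genericPoly ha]))
  refine natDegree_sum_le_of_forall_le _ _ fun j _ => ?_
  exact (natDegree_C_mul_X_pow_le _ _).trans (ha.monotone (Fin.le_last j))

/-- Up to sign, the resultant of f and f' is the leading coefficient times the discriminant, and a
nonzero resultant means that f and f' are coprime. -/
theorem separable_of_discr_ne_zero {f : ℂ[X]} (hf : 0 < f.natDegree) (hd : f.discr ≠ 0) :
    f.Separable := by
  have hf0 : f ≠ 0 := by rintro rfl; simp at hf
  have h := resultant_deriv (natDegree_pos_iff_degree_pos.1 hf)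
  have hne : resultant f (derivative f) ≠ 0 := by
    rw [natDegree_derivative, h]
    exact mul_ne_zero (mul_ne_zero (pow_ne_zero _ (by norm_num)) (leadingCoeff_ne_zero.2 hf0)) hd
  rw [Ne, resultant_eq_zero_iff] at hne
  simpa [hf0, Separable] using hne

theorem last_pos {a : Fin (m + 2) → ℕ} (ha : StrictMono a) : 0 < a (Fin.last (m + 1)) :=
  (Nat.zero_le _).trans_lt (ha (show (0 : Fin (m + 2)) < Fin.last (m + 1) from Fin.last_pos))

variable {a : Fin (m + 2) → ℕ} (ha : StrictMono a) {x : Fin (m + 2) → ℂ}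
  (hx : x ∉ singularLocus a)
include ha hx

theorem separable_genericPoly : (genericPoly a x).Separable := by
  simp only [singularLocus, Set.mem_ofPred_eq, not_or] at hx
  exact separable_of_discr_ne_zero (by rw [natDegree_genericPoly ha hx.2.1]; exact last_pos ha)
    hx.2.2

theorem eval_derivative_ne_zero {t : ℂ} (ht : (genericPoly a x).eval t = 0) :
    (genericPoly a x).derivative.eval t ≠ 0 := by
  have := (separable_genericPoly ha hx).eval₂_derivative_ne_zero (RingHom.id ℂ) (x := t) ht
  simpa using this

theorem genericPoly_ne_zero : genericPoly a x ≠ 0 :=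
  (separable_genericPoly ha hx).ne_zero

theorem card_roots_genericPoly :
    (genericPoly a x).roots.toFinset.card = a (Fin.last (m + 1)) := by
  have hs := separable_genericPoly ha hx
  simp only [singularLocus, Set.mem_ofPred_eq, not_or] at hx
  rw [Multiset.toFinset_card_of_nodup (nodup_roots hs), ← natDegree_genericPoly ha hx.2.1]
  exact (splits_iff_card_roots.1 (IsAlgClosed.splits _))

theorem root_ne_zero (ha0 : a 0 = 0) {t : ℂ} (ht : (genericPoly a x).eval t = 0) : t ≠ 0 := by
  rintro rfl
  simp only [singularLocus, Set.mem_ofPred_eq, not_or] at hx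
  apply hx.1
  rw [← coeff_genericPoly ha x 0, ha0, coeff_zero_eq_eval_zero, ht]

end GenericPolynomial

/-! ### Local roots from the implicit function theorem -/

section ImplicitRoot

variable {n : ℕ} (a : Fin n → ℕ)

/-- The derivative of `(x, t) ↦ f(x; t)` in the variable `x`. -/
noncomputable def coeffDeriv (t : ℂ) : (Fin n → ℂ) →L[ℂ] ℂ :=
  ∑ j, t ^ a j • ContinuousLinearMap.proj j

/-- Local form of the zero set of `f(x; t)` at a simple root. -/
theorem exists_local_root {x₀ : Fin n → ℂ} {t₀ : ℂ} (h0 : (genericPoly a x₀).eval t₀ = 0)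
    (h1 : (genericPoly a x₀).derivative.eval t₀ ≠ 0) :
    ∃ ψ : (Fin n → ℂ) → ℂ, ψ x₀ = t₀ ∧ DifferentiableAt ℂ ψ x₀ ∧
      (∃ s ∈ 𝓝 x₀, ContinuousOn ψ s) ∧ (∀ᶠ x in 𝓝 x₀, (genericPoly a x).eval (ψ x) = 0) ∧
      ∀ᶠ v : (Fin n → ℂ) × ℂ in 𝓝 (x₀, t₀), (genericPoly a v.1).eval v.2 = 0 ↔ ψ v.1 = v.2 := by
  let f : (Fin n → ℂ) → ℂ → ℂ := fun x t => ∑ j, x j * t ^ a j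
  let f₁ : (Fin n → ℂ) → ℂ → (Fin n → ℂ) →L[ℂ] ℂ := fun x t => coeffDeriv a t
  let f₂ : (Fin n → ℂ) → ℂ → ℂ →L[ℂ] ℂ := fun x t =>
    ContinuousLinearMap.toSpanSingleton ℂ (∑ j, x j * (a j * t ^ (a j - 1)))
  have df₁ : ∀ᶠ v : (Fin n → ℂ) × ℂ in 𝓝 (x₀, t₀), HasFDerivAt (f · v.2) (f₁ v.1 v.2) v.1 := by
    refine Eventually.of_forall fun v => ?_
    refine HasFDerivAt.fun_sum fun j _ => ?_
    exact (hasFDerivAt_apply j v.1).mul_const _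
  have df₂ : ∀ᶠ v : (Fin n → ℂ) × ℂ in 𝓝 (x₀, t₀), HasFDerivAt (f v.1 ·) (f₂ v.1 v.2) v.2 := by
    refine Eventually.of_forall fun v => ?_
    have : HasDerivAt (f v.1 ·) (∑ j, v.1 j * (a j * v.2 ^ (a j - 1))) v.2 :=
      HasDerivAt.fun_sum fun j _ => (hasDerivAt_pow (a j) v.2).const_mul (v.1 j)
    exact this.hasFDerivAt
  have cf₁ : ContinuousAt ↿f₁ (x₀, t₀) := by
    have : Continuous fun v : (Fin n → ℂ) × ℂ => coeffDeriv a v.2 := by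
      unfold coeffDeriv
      fun_prop
    exact this.continuousAt
  have cf₂ : ContinuousAt ↿f₂ (x₀, t₀) := by
    have : Continuous fun v : (Fin n → ℂ) × ℂ => ContinuousLinearMap.toSpanSingleton ℂ
        (∑ j, v.1 j * (a j * v.2 ^ (a j - 1)) : ℂ) := by
      refine (ContinuousLinearMap.toSpanSingletonCLE (𝕜 := ℂ) (E := ℂ)).continuous.comp ?_
      fun_prop
    exact this.continuousAt
  have inv : (f₂ (x₀, t₀).1 (x₀, t₀).2).IsInvertible := by
    rw [eval_derivative_genericPoly] at h1
    refine ⟨ContinuousLinearEquiv.unitsEquivAut ℂ (Units.mk0 _ h1), ?_⟩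
    ext
    simp [f₂]
  refine ⟨implicitFunctionOfBivariate df₁ df₂ cf₁ cf₂ inv, ?_, ?_, ?_, ?_, ?_⟩
  · exact (eventually_apply_eq_iff_implicitFunctionOfBivariate df₁ df₂ cf₁ cf₂ inv).self_of_nhds.1
      rfl
  · exact (hasStrictFDerivAt_implicitFunctionOfBivariate df₁ df₂ cf₁ cf₂ inv).differentiableAt
  -- Differentiability at `x₀` gives continuity at that point only. Strict differentiability gives a
  -- Lipschitz bound on a neighbourhood, and this makes the sheets of the covering open.
  · obtain ⟨K, s, hs, hK⟩ :=
      (hasStrictFDerivAt_implicitFunctionOfBivariate df₁ df₂ cf₁ cf₂ inv).exists_lipschitzOnWith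
    exact ⟨s, hs, hK.continuousOn⟩
  · filter_upwards [eventually_apply_implicitFunctionOfBivariate df₁ df₂ cf₁ cf₂ inv] with x hx
    rw [eval_genericPoly] at h0 ⊢
    exact hx.trans h0
  · filter_upwards [eventually_apply_eq_iff_implicitFunctionOfBivariate df₁ df₂ cf₁ cf₂ inv]
      with v hv
    rw [← hv, eval_genericPoly]
    rw [eval_genericPoly] at h0
    change f v.1 v.2 = 0 ↔ f v.1 v.2 = f x₀ t₀
    rw [show f x₀ t₀ = 0 from h0]

end ImplicitRoot

theorem zeroExt_coe {n : ℕ} {U : Set (Fin n → ℂ)} (g : U → ℂ) (x : U) : zeroExt g x = g x :=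
  Subtype.val_injective.extend_apply g 0 x

theorem continuous_of_isHolomorphic {n : ℕ} {U : Set (Fin n → ℂ)} {g : U → ℂ}
    (hg : IsHolomorphic g) : Continuous g := by
  have := hg.continuousOn.comp_continuous (f := Subtype.val) continuous_subtype_val fun x => x.2
  exact this.congr fun x => zeroExt_coe g x

/-! ### Global roots as sections of a covering -/

section Covering

variable {m : ℕ} {a : Fin (m + 2) → ℕ} {U : Set (Fin (m + 2) → ℂ)}

/-- The incidence variety of pairs `(x, t)` with `x ∈ U` and `f(x; t) = 0`. -/
abbrev RootSpace (a : Fin (m + 2) → ℕ) (U : Set (Fin (m + 2) → ℂ)) : Type :=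
  {p : U × ℂ // (genericPoly a (p.1 : Fin (m + 2) → ℂ)).eval p.2 = 0}

/-- The projection of the incidence variety to `U`. -/
def rootProj (a : Fin (m + 2) → ℕ) (U : Set (Fin (m + 2) → ℂ)) (e : RootSpace a U) : U := e.1.1

theorem continuous_rootProj : Continuous (rootProj a U) :=
  continuous_fst.comp continuous_subtype_val

/-- The d simple roots over `x₀` extend to d local root functions, distinct near `x₀`. Every fibre
has exactly d points, so these functions exhaust the nearby fibres and their graphs are the sheets.
-/
theorem isCoveringMap_rootProj (ha : StrictMono a) (hUS : U ⊆ (singularLocus a)ᶜ) :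
    IsCoveringMap (rootProj a U) := by
  classical
  intro x₀
  let J : Type := (genericPoly a (x₀ : Fin (m + 2) → ℂ)).roots.toFinset
  have hx₀ : (x₀ : Fin (m + 2) → ℂ) ∉ singularLocus a := hUS x₀.2
  have hmem : ∀ x : U, ∀ r, r ∈ (genericPoly a (x : Fin (m + 2) → ℂ)).roots.toFinset ↔
      (genericPoly a (x : Fin (m + 2) → ℂ)).eval r = 0 := fun x r => by
    rw [Multiset.mem_toFinset, mem_roots (genericPoly_ne_zero ha (hUS x.2)), IsRoot]
  have hroot : ∀ r : J, (genericPoly a (x₀ : Fin (m + 2) → ℂ)).eval (r : ℂ) = 0 :=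
    fun r => (hmem x₀ r).1 r.2
  choose ψ hψ0 hψd hψc hψr hψu using fun r : J =>
    exists_local_root a (hroot r) (eval_derivative_ne_zero ha hx₀ (hroot r))
  have hdist : ∀ᶠ x in 𝓝 (x₀ : Fin (m + 2) → ℂ), Function.Injective fun r => ψ r x := by
    have : ∀ p : J × J, ∀ᶠ x in 𝓝 (x₀ : Fin (m + 2) → ℂ), ψ p.1 x = ψ p.2 x → p.1 = p.2 := by
      intro p
      by_cases hp : p.1 = p.2
      · exact Eventually.of_forall fun _ _ => hp
      · have hne : ψ p.1 x₀ ≠ ψ p.2 x₀ := by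
          rw [hψ0, hψ0]
          exact fun h => hp (Subtype.ext h)
        filter_upwards [((hψd p.1).continuousAt.sub (hψd p.2).continuousAt).eventually_ne
          (sub_ne_zero.2 hne)] with x hx h
        exact absurd h (sub_ne_zero.1 hx)
    filter_upwards [eventually_all.2 this] with x hx r r' h
    exact hx (r, r') h
  choose s hs hsc using hψc
  obtain ⟨W, hW, hWo, hxW⟩ := mem_nhds_iff.1
    (inter_mem (inter_mem (eventually_all.2 hψr) hdist) (iInter_mem.2 hs))
  have hWr : ∀ x ∈ W, ∀ r, (genericPoly a x).eval (ψ r x) = 0 := fun x hx => (hW hx).1.1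
  have hWi : ∀ x ∈ W, Function.Injective fun r => ψ r x := fun x hx => (hW hx).1.2
  have hWc : ∀ r, ContinuousOn (ψ r) W := fun r =>
    (hsc r).mono fun x hx => Set.mem_iInter.1 (hW hx).2 r
  have hexh : ∀ x : U, (x : Fin (m + 2) → ℂ) ∈ W → ∀ t,
      (genericPoly a (x : Fin (m + 2) → ℂ)).eval t = 0 → ∃ r, ψ r x = t := by
    intro x hx t ht
    have hcard : Fintype.card J =
        (genericPoly a (x : Fin (m + 2) → ℂ)).roots.toFinset.card := by
      rw [card_roots_genericPoly ha (hUS x.2), Fintype.card_coe, card_roots_genericPoly ha hx₀]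
    have hsub : Finset.univ.image (fun r => ψ r x) =
        (genericPoly a (x : Fin (m + 2) → ℂ)).roots.toFinset := by
      refine Finset.eq_of_subset_of_card_le ?_ ?_
      · intro t ht
        obtain ⟨r, -, rfl⟩ := Finset.mem_image.1 ht
        exact (hmem x _).2 (hWr x hx r)
      · rw [Finset.card_image_of_injective _ (hWi x hx), Finset.card_univ, hcard]
    have := (hmem x t).2 ht
    rw [← hsub] at this
    obtain ⟨r, -, h⟩ := Finset.mem_image.1 this
    exact ⟨r, h⟩
  let V : Set U := Subtype.val ⁻¹' W
  have hV : IsOpen V := hWo.preimage continuous_subtype_val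
  have hJ : Nonempty J := by
    have : 0 < Fintype.card J := by
      rw [Fintype.card_coe, card_roots_genericPoly ha hx₀]
      exact last_pos ha
    exact Fintype.card_pos_iff.1 this
  have hsec : Nonempty (U → RootSpace a U) := by
    have hex : ∀ x : U, ∃ t, (genericPoly a (x : Fin (m + 2) → ℂ)).eval t = 0 := ?_
    · choose r hr using hex
      exact ⟨fun x => ⟨(x, r x), hr x⟩⟩
    intro x
    have : 0 < (genericPoly a (x : Fin (m + 2) → ℂ)).roots.toFinset.card := by
      rw [card_roots_genericPoly ha (hUS x.2)]
      exact last_pos ha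
    obtain ⟨t, ht⟩ := Finset.card_pos.1 this
    exact ⟨t, (hmem x t).1 ht⟩
  let S : J → Set (RootSpace a U) := fun r =>
    {e | (e.1.1 : Fin (m + 2) → ℂ) ∈ W ∧ ψ r e.1.1 = e.1.2}
  have hSW : ∀ r, ContinuousOn (fun e : RootSpace a U => ψ r e.1.1) (rootProj a U ⁻¹' V) := by
    intro r
    refine (hWc r).comp (Continuous.continuousOn (by fun_prop)) fun e he => he
  have hSo : ∀ r, IsOpen (S r) := by
    intro r
    have h1 : ∀ r', IsOpen {e : RootSpace a U | e ∈ rootProj a U ⁻¹' V ∧ ψ r' e.1.1 ≠ e.1.2} := by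
      intro r'
      have hc : ContinuousOn (fun e : RootSpace a U => ψ r' e.1.1 - e.1.2)
          (rootProj a U ⁻¹' V) := (hSW r').sub (Continuous.continuousOn (by fun_prop))
      have := hc.isOpen_inter_preimage (hV.preimage continuous_rootProj)
        (isOpen_compl_singleton (x := (0 : ℂ)))
      convert this using 1
      ext e
      simp [sub_eq_zero]
    -- An equation such as `ψ r e.1.1 = e.1.2` is a closed condition. The sheet is open because it
    -- is the complement of the finitely many other sheets.
    have h2 : S r = ⋂ r' : J, {e : RootSpace a U | e ∈ rootProj a U ⁻¹' V ∧
        (r' ≠ r → ψ r' e.1.1 ≠ e.1.2)} := by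
      ext e
      simp only [S, Set.mem_iInter]
      constructor
      · rintro ⟨h, h'⟩ r'
        refine ⟨h, fun hne h'' => hne (hWi _ h (h''.trans h'.symm))⟩
      · intro h
        refine ⟨(h r).1, ?_⟩
        obtain ⟨r', hr'⟩ := hexh e.1.1 (h r).1 e.1.2 e.2
        by_cases hrr : r' = r
        · rw [← hrr, hr']
        · exact absurd hr' ((h r').2 hrr)
    rw [h2]
    refine isOpen_iInter_of_finite fun r' => ?_
    by_cases hrr : r' = r
    · simp only [hrr, ne_eq, not_true_eq_false, false_implies, and_true]
      exact hV.preimage continuous_rootProj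
    · simpa [hrr] using h1 r'
  have hsurj : ∀ r, Set.SurjOn (rootProj a U) (S r) V := by
    intro r x hx
    exact ⟨⟨(x, ψ r x), hWr x hx r⟩, ⟨hx, rfl⟩, rfl⟩
  have key := IsEvenlyCovered.of_trivialization (x := x₀)
    (t := hV.trivializationDiscrete (f := rootProj a U) S V (fun r {Y} hY => ⟨fun h => ?_, fun h => ?_⟩)
    (fun r e he e' he' h => ?_) hsurj (fun r r' hne => ?_) fun e he => ?_) hxW
  · exact key.to_isEvenlyCovered_preimage
  · exact (h.preimage continuous_rootProj).inter (hSo r)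
  · let σ : V → RootSpace a U := fun x => ⟨(x, ψ r x), hWr x x.2 r⟩
    have hσ : Continuous σ := by
      refine Continuous.subtype_mk (continuous_subtype_val.prodMk ?_) _
      exact (hWc r).comp_continuous (by fun_prop) fun x => x.2
    have : Y = Subtype.val '' (σ ⁻¹' (rootProj a U ⁻¹' Y ∩ S r)) := by
      ext x
      constructor
      · intro hx
        exact ⟨⟨x, hY hx⟩, ⟨hx, hY hx, rfl⟩, rfl⟩
      · rintro ⟨y, hy, rfl⟩
        exact hy.1
    rw [this]
    exact hV.isOpenMap_subtype_val _ (h.preimage hσ)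
  · have h1 : e.1.1 = e'.1.1 := h
    refine Subtype.ext (Prod.ext h1 ?_)
    rw [← he.2, ← he'.2, h1]
  · refine Set.disjoint_left.2 fun e he he' => hne (hWi _ he.1 (he.2.trans he'.2.symm))
  · obtain ⟨r, hr⟩ := hexh e.1.1 he e.1.2 e.2
    exact Set.mem_iUnion.2 ⟨r, he, hr⟩

variable (ha : StrictMono a) (hUo : IsOpen U) (hUS : U ⊆ (singularLocus a)ᶜ)
include ha hUo hUS

/-- By continuity the graph stays in the region where the implicit function is the only solution, so
near each point ρ coincides with a differentiable local root. -/
theorem isHolomorphic_of_continuous_root {ρ : U → ℂ} (hρ : Continuous ρ)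
    (hroot : ∀ x : U, (genericPoly a (x : Fin (m + 2) → ℂ)).eval (ρ x) = 0) :
    IsHolomorphic ρ := by
  intro x hx
  obtain ⟨ψ, -, hψd, -, -, hψ⟩ := exists_local_root a (hroot ⟨x, hx⟩)
    (eval_derivative_ne_zero ha (hUS hx) (hroot ⟨x, hx⟩))
  refine DifferentiableAt.differentiableWithinAt (hψd.congr_of_eventuallyEq ?_)
  have hext : ContinuousAt (zeroExt ρ) x := by
    have : ContinuousOn (zeroExt ρ) U := by
      rw [continuousOn_iff_continuous_domRestrict]
      convert hρ using 1
      ext y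
      exact zeroExt_coe ρ y
    exact this.continuousAt (hUo.mem_nhds hx)
  have htend : Tendsto (fun y => (y, zeroExt ρ y)) (𝓝 x) (𝓝 (x, ρ ⟨x, hx⟩)) := by
    rw [← zeroExt_coe ρ ⟨x, hx⟩]
    exact (continuousAt_id.prodMk hext).tendsto
  filter_upwards [htend.eventually hψ, hUo.mem_nhds hx] with y hy hyU
  refine (hy.1 ?_).symm
  have := hroot ⟨y, hyU⟩
  rwa [← zeroExt_coe ρ] at this

theorem exists_mem_rootsOn (hUc : IsSimplyConnected U) (x₀ : U) {t : ℂ}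
    (ht : (genericPoly a (x₀ : Fin (m + 2) → ℂ)).eval t = 0) : ∃ ρ ∈ rootsOn a U, ρ x₀ = t := by
  have := hUc.simplyConnectedSpace
  have := hUo.locallyPathConnectedSpace
  obtain ⟨F, ⟨hF0, hF⟩, -⟩ :=
    (isCoveringMap_rootProj ha hUS).existsUnique_continuousMap_lifts (ContinuousMap.id U) x₀
      ⟨(x₀, t), ht⟩ rfl
  have hF' : ∀ x, (F x).1.1 = x := fun x => congrFun hF x
  have hroot : ∀ x : U, (genericPoly a (x : Fin (m + 2) → ℂ)).eval (F x).1.2 = 0 := fun x => by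
    have := (F x).2
    rwa [hF'] at this
  refine ⟨fun x => (F x).1.2, ⟨isHolomorphic_of_continuous_root ha hUo hUS ?_ hroot, hroot⟩, ?_⟩
  · fun_prop
  · simp [hF0]

omit hUo in
theorem eq_of_mem_rootsOn (hUc : IsPreconnected U) {ρ σ : U → ℂ}
    (hρ : ρ ∈ rootsOn a U) (hσ : σ ∈ rootsOn a U) {x₀ : U} (h : ρ x₀ = σ x₀) : ρ = σ := by
  have : PreconnectedSpace U := Subtype.preconnectedSpace hUc
  have hρc := continuous_of_isHolomorphic hρ.1
  have hσc := continuous_of_isHolomorphic hσ.1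
  have := (isCoveringMap_rootProj ha hUS).eq_of_comp_eq
    (g₁ := fun x : U => (⟨(x, ρ x), hρ.2 x⟩ : RootSpace a U))
    (g₂ := fun x : U => (⟨(x, σ x), hσ.2 x⟩ : RootSpace a U))
    (by fun_prop) (by fun_prop) rfl x₀ (by simp [h])
  ext x
  have hx := congrFun this x
  simp only [Subtype.mk.injEq, Prod.mk.injEq] at hx
  exact hx.2

/-- Evaluation at a base point is a bijection onto the d roots there: injective by uniqueness of
lifts, surjective by their existence over a simply connected set. -/
theorem ncard_rootsOn (hUc : IsSimplyConnected U) :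
    (rootsOn a U).ncard = a (Fin.last (m + 1)) := by
  classical
  obtain ⟨x₀, hx₀⟩ := hUc.nonempty
  have hpre : IsPreconnected U := hUc.isPathConnected.isConnected.isPreconnected
  rw [← card_roots_genericPoly ha (hUS hx₀), ← Set.ncard_coe_finset]
  refine Set.ncard_congr (fun ρ _ => ρ ⟨x₀, hx₀⟩) (fun ρ hρ => ?_)
    (fun ρ σ hρ hσ h => eq_of_mem_rootsOn ha hUS hpre hρ hσ h) fun t ht => ?_
  · rw [Finset.mem_coe, Multiset.mem_toFinset, mem_roots (genericPoly_ne_zero ha (hUS hx₀))]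
    exact hρ.2 _
  · rw [Finset.mem_coe, Multiset.mem_toFinset, mem_roots (genericPoly_ne_zero ha (hUS hx₀))] at ht
    obtain ⟨ρ, hρ, h⟩ := exists_mem_rootsOn ha hUo hUS hUc ⟨x₀, hx₀⟩ ht
    exact ⟨ρ, hρ, h⟩

end Covering

/-! ### Holomorphic logarithms -/

section LogBranch

variable {n : ℕ} {U : Set (Fin n → ℂ)}

/-- A continuous logarithm exists by simple connectedness. It is locally g followed by a local
inverse of exp, hence holomorphic. -/
theorem exists_isLogBranch (hUo : IsOpen U) (hUc : IsSimplyConnected U) {g : U → ℂ}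
    (hg : IsHolomorphic g) (h0 : ∀ x, g x ≠ 0) : ∃ l : U → ℂ, IsLogBranch l g := by
  have hne : 0 ∉ zeroExt g '' U := by
    rintro ⟨x, hx, h⟩
    exact h0 ⟨x, hx⟩ (by rw [← h, ← zeroExt_coe g])
  obtain ⟨F, hFc, hF⟩ :=
    Complex.exists_continuousOn_eqOn_exp_comp hUc hUo hg.continuousOn hne
  refine ⟨fun x => F x, ?_, fun x => (hF x.2).trans (zeroExt_coe g x)⟩
  have hd : DifferentiableOn ℂ F U := by
    intro x hx
    have hexp := (Complex.hasStrictDerivAt_exp (F x)).hasStrictFDerivAt_equiv (Complex.exp_ne_zero _)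
    have hloc := hexp.to_localInverse
    have hev := hexp.eventually_left_inverse
    have hcont : ContinuousAt F x := hFc.continuousAt (hUo.mem_nhds hx)
    have hgd : DifferentiableAt ℂ (zeroExt g) x := hg.differentiableAt (hUo.mem_nhds hx)
    have h1 : DifferentiableAt ℂ (hexp.localInverse _ _ _ ∘ zeroExt g) x := by
      refine DifferentiableAt.comp x ?_ hgd
      rw [← hF hx]
      exact hloc.differentiableAt
    refine (h1.congr_of_eventuallyEq ?_).differentiableWithinAt
    filter_upwards [hcont.eventually hev, hUo.mem_nhds hx] with y hy hyU
    rw [Function.comp_apply, ← hF hyU]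
    exact hy.symm
  refine hd.congr fun x hx => ?_
  exact zeroExt_coe _ (⟨x, hx⟩ : U)

end LogBranch

/-! ### Calculus of partial derivatives on an open set -/

section PartialDeriv

variable {n : ℕ} {U : Set (Fin n → ℂ)} {F G : (Fin n → ℂ) → ℂ}

theorem eqOn_partialDeriv (hUo : IsOpen U) (h : Set.EqOn F G U) (j : Fin n) :
    Set.EqOn (partialDeriv j F) (partialDeriv j G) U := fun x hx => by
  have : F =ᶠ[𝓝 x] G := h.eventuallyEq_of_mem (hUo.mem_nhds hx)
  simp only [partialDeriv, this.fderiv_eq]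

theorem eqOn_iterate_partialDeriv (hUo : IsOpen U) (h : Set.EqOn F G U) (j : Fin n) (k : ℕ) :
    Set.EqOn ((partialDeriv j)^[k] F) ((partialDeriv j)^[k] G) U := by
  induction k with
  | zero => exact h
  | succ k ih =>
    rw [Function.iterate_succ_apply', Function.iterate_succ_apply']
    exact eqOn_partialDeriv hUo ih j

theorem eqOn_monomialDeriv (hUo : IsOpen U) (h : Set.EqOn F G U) (u : Fin n → ℕ) :
    Set.EqOn (monomialDeriv u F) (monomialDeriv u G) U := by
  unfold monomialDeriv
  induction List.finRange n with
  | nil => exact h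
  | cons j t ih => exact eqOn_iterate_partialDeriv hUo ih j _

theorem contDiffOn_partialDeriv (hUo : IsOpen U) (hF : ContDiffOn ℂ ∞ F U) (j : Fin n) :
    ContDiffOn ℂ ∞ (partialDeriv j F) U :=
  (hF.fderiv_of_isOpen hUo le_rfl).clm_apply contDiffOn_const

theorem contDiffOn_iterate_partialDeriv (hUo : IsOpen U) (hF : ContDiffOn ℂ ∞ F U) (j : Fin n)
    (k : ℕ) : ContDiffOn ℂ ∞ ((partialDeriv j)^[k] F) U := by
  induction k with
  | zero => exact hF
  | succ k ih =>
    rw [Function.iterate_succ_apply']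
    exact contDiffOn_partialDeriv hUo ih j

theorem partialDeriv_comm (hUo : IsOpen U) (hF : ContDiffOn ℂ ∞ F U) (i j : Fin n) :
    Set.EqOn (partialDeriv i (partialDeriv j F)) (partialDeriv j (partialDeriv i F)) U := by
  intro x hx
  have hFx : ContDiffAt ℂ ∞ F x := hF.contDiffAt (hUo.mem_nhds hx)
  have hsymm : IsSymmSndFDerivAt ℂ F x :=
    hFx.isSymmSndFDerivAt (by
      rw [minSmoothness_of_isRCLikeNormedField]
      exact WithTop.coe_le_coe.2 le_top)
  have hd : DifferentiableAt ℂ (fderiv ℂ F) x :=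
    (((hF.fderiv_of_isOpen hUo (m := ∞) le_rfl).contDiffAt (hUo.mem_nhds hx)).differentiableAt
      (by simp))
  have key : ∀ i j : Fin n, partialDeriv i (partialDeriv j F) x =
      fderiv ℂ (fderiv ℂ F) x (Pi.single i 1) (Pi.single j 1) := by
    intro i j
    change fderiv ℂ (fun y => fderiv ℂ F y (Pi.single j 1)) x (Pi.single i 1) = _
    rw [fderiv_clm_apply hd (differentiableAt_const _)]
    simp
  rw [key, key]
  exact hsymm _ _

theorem partialDeriv_iterate_comm (hUo : IsOpen U) (hF : ContDiffOn ℂ ∞ F U) (i j : Fin n)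
    (k : ℕ) : Set.EqOn (partialDeriv i ((partialDeriv j)^[k] F))
      ((partialDeriv j)^[k] (partialDeriv i F)) U := by
  induction k with
  | zero => exact fun _ _ => rfl
  | succ k ih =>
    rw [Function.iterate_succ_apply', Function.iterate_succ_apply']
    exact (partialDeriv_comm hUo (contDiffOn_iterate_partialDeriv hUo hF j k) i j).trans
      (eqOn_partialDeriv hUo ih j)

theorem fderiv_eq_sum_partialDeriv (x : Fin n → ℂ) :
    fderiv ℂ F x = ∑ j, partialDeriv j F x • ContinuousLinearMap.proj (R := ℂ) j := by
  refine ContinuousLinearMap.ext fun v => ?_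
  conv_lhs => rw [pi_eq_sum_univ' v]
  simp [partialDeriv, mul_comm]

/-- Bootstrapping: if the partial derivatives inherit C^N from F, then F is C^{N+1}. This suits
roots, whose derivatives are rational expressions in the root itself. -/
theorem contDiffOn_infty_of_partialDeriv (hUo : IsOpen U) (hF : DifferentiableOn ℂ F U)
    (h : ∀ N : ℕ, ContDiffOn ℂ N F U → ∀ j, ContDiffOn ℂ N (partialDeriv j F) U) :
    ContDiffOn ℂ ∞ F U := by
  refine contDiffOn_infty.2 fun N => ?_
  induction N with
  | zero => exact contDiffOn_zero.2 hF.continuousOn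
  | succ N ih =>
    push_cast
    rw [contDiffOn_succ_iff_fderiv_of_isOpen hUo]
    refine ⟨hF, by simp, ?_⟩
    rw [funext fderiv_eq_sum_partialDeriv]
    exact ContDiffOn.sum fun j _ => (h N ih j).smul contDiffOn_const

theorem contDiffOn_zpow {N : ℕ∞ω} (hF : ContDiffOn ℂ N F U) (h0 : ∀ x ∈ U, F x ≠ 0)
    (p : ℤ) : ContDiffOn ℂ N (fun x => F x ^ p) U := by
  obtain ⟨k, rfl | rfl⟩ := p.eq_nat_or_neg
  · simpa using hF.pow k
  · simp only [zpow_neg, zpow_natCast]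
    exact (hF.pow k).inv fun x hx => pow_ne_zero _ (h0 x hx)

end PartialDeriv

/-! ### Derivatives of a root -/

section Roots

variable {n : ℕ} {U : Set (Fin n → ℂ)} {a : Fin n → ℕ} {R : (Fin n → ℂ) → ℂ}

/-- Differentiate the identity f(y; R(y)) = 0 in y and solve for the derivative of R. -/
theorem partialDeriv_root {x : Fin n → ℂ} (hR : DifferentiableAt ℂ R x)
    (hroot : ∀ᶠ y in 𝓝 x, (genericPoly a y).eval (R y) = 0)
    (h1 : (genericPoly a x).derivative.eval (R x) ≠ 0) (j : Fin n) :
    partialDeriv j R x = -R x ^ a j / (genericPoly a x).derivative.eval (R x) := by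
  have hd : HasFDerivAt (fun y : Fin n → ℂ => ∑ i, y i * R y ^ a i)
      (∑ i, (x i • ((a i • R x ^ (a i - 1)) • fderiv ℂ R x) +
        R x ^ a i • ContinuousLinearMap.proj (R := ℂ) i)) x := by
    refine HasFDerivAt.fun_sum fun i _ => ?_
    exact (hasFDerivAt_apply i x).mul (hR.hasFDerivAt.pow (a i))
  have hz : HasFDerivAt (fun y : Fin n → ℂ => ∑ i, y i * R y ^ a i)
      (0 : (Fin n → ℂ) →L[ℂ] ℂ) x := by
    refine (hasFDerivAt_const (0 : ℂ) x).congr_of_eventuallyEq ?_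
    filter_upwards [hroot] with y hy
    rw [← eval_genericPoly, hy]
  have := congrArg (fun T => T (Pi.single j 1)) (hd.unique hz)
  simp [Finset.sum_add_distrib, Pi.single_apply] at this
  rw [eq_div_iff h1, eval_derivative_genericPoly, Finset.mul_sum, partialDeriv]
  rw [eq_neg_iff_add_eq_zero, ← this]
  congr 1
  exact Finset.sum_congr rfl fun i _ => by ring

end Roots

/-! ### Divided monomials and their weighted sums -/

section DividedMonomial

variable {n : ℕ}

/-- The monomial `x^u / u!`. -/
noncomputable def dividedMonomial (u : Fin n → ℕ) (x : Fin n → ℂ) : ℂ :=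
  ∏ j, x j ^ u j / ((u j).factorial : ℂ)

theorem contDiff_dividedMonomial (u : Fin n → ℕ) {N : ℕ∞ω} :
    ContDiff ℂ N (dividedMonomial u) := by
  unfold dividedMonomial
  exact contDiff_prod fun j _ => ((contDiff_apply ℂ ℂ j).pow _).div_const _

theorem partialDeriv_dividedMonomial_eq (u : Fin n → ℕ) (j : Fin n) (x : Fin n → ℂ) :
    partialDeriv j (dividedMonomial u) x =
      (∏ i ∈ Finset.univ.erase j, x i ^ u i / ((u i).factorial : ℂ)) *
        (u j * x j ^ (u j - 1) / ((u j).factorial : ℂ)) := by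
  have hd : HasFDerivAt (dividedMonomial u)
      (∑ i, (∏ k ∈ Finset.univ.erase i, x k ^ u k / ((u k).factorial : ℂ)) •
        (((u i).factorial : ℂ)⁻¹ • ((u i • x i ^ (u i - 1)) •
          ContinuousLinearMap.proj (R := ℂ) (φ := fun _ : Fin n => ℂ) i))) x := by
    refine HasFDerivAt.finsetProd fun i _ => ?_
    simp only [div_eq_mul_inv]
    exact ((hasFDerivAt_apply i x).pow (u i)).mul_const _
  rw [partialDeriv, hd.fderiv]
  simp [Pi.single_apply]
  left
  ring

theorem partialDeriv_dividedMonomial (u : Fin n → ℕ) (j : Fin n) (x : Fin n → ℂ) :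
    partialDeriv j (dividedMonomial u) x =
      if u j = 0 then 0 else dividedMonomial (u - Pi.single j 1) x := by
  rw [partialDeriv_dividedMonomial_eq]
  split_ifs with h
  · simp [h]
  · rw [dividedMonomial, ← Finset.prod_erase_mul _ _ (Finset.mem_univ j)]
    congr 1
    · refine Finset.prod_congr rfl fun i hi => ?_
      simp [Finset.ne_of_mem_erase hi]
    · obtain ⟨k, hk⟩ := Nat.exists_eq_succ_of_ne_zero h
      have : ((k.factorial : ℕ) : ℂ) ≠ 0 := by exact_mod_cast k.factorial_ne_zero
      have : ((k + 1 : ℕ) : ℂ) ≠ 0 := by exact_mod_cast k.succ_ne_zero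
      simp only [Pi.sub_apply, Pi.single_eq_same, hk, Nat.succ_eq_add_one, Nat.add_sub_cancel,
        Nat.factorial_succ, Nat.cast_mul]
      field_simp

theorem mul_partialDeriv_dividedMonomial (u : Fin n → ℕ) (j : Fin n) (x : Fin n → ℂ) :
    x j * partialDeriv j (dividedMonomial u) x = u j * dividedMonomial u x := by
  rw [partialDeriv_dividedMonomial_eq, dividedMonomial,
    ← Finset.prod_erase_mul _ _ (Finset.mem_univ j)]
  rcases Nat.eq_zero_or_pos (u j) with h | h
  · simp [h]
  · obtain ⟨k, hk⟩ := Nat.exists_eq_succ_of_ne_zero h.ne'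
    simp only [hk, Nat.succ_eq_add_one, Nat.add_sub_cancel]
    ring

end DividedMonomial

section HyperSum

variable {n : ℕ} (a : Fin n → ℕ)

/-- The sum of `w(∑ a_j u_j) x^u / u!` over all `u ∈ ℕⁿ` with `|u| = k`. -/
noncomputable def hyperSum (k : ℕ) (w : ℕ → ℂ) (x : Fin n → ℂ) : ℂ :=
  ∑ u ∈ Finset.piAntidiag Finset.univ k, dividedMonomial u x * w (∑ j, a j * u j)

theorem hyperSum_zero (w : ℕ → ℂ) (x : Fin n → ℂ) : hyperSum a 0 w x = w 0 := by
  simp [hyperSum, dividedMonomial]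

theorem contDiff_hyperSum (k : ℕ) (w : ℕ → ℂ) {N : ℕ∞ω} : ContDiff ℂ N (hyperSum a k w) := by
  unfold hyperSum
  exact ContDiff.sum fun u _ => (contDiff_dividedMonomial u).mul contDiff_const

/-- ∂_j turns x^u/u! into the divided monomial of u - e_j, or into 0 when u_j = 0. Reindexing by u =
u' + e_j raises the argument of the weight by a_j. -/
theorem sum_partialDeriv_dividedMonomial (k : ℕ) (w : ℕ → ℂ) (x : Fin n → ℂ) (j : Fin n) :
    ∑ u ∈ Finset.piAntidiag Finset.univ (k + 1),
      partialDeriv j (dividedMonomial u) x * w (∑ i, a i * u i) =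
      hyperSum a k (fun p => w (p + a j)) x := by
  classical
  simp only [partialDeriv_dividedMonomial, ite_mul, zero_mul]
  rw [hyperSum, Finset.sum_congr rfl fun u _ => (ite_not _ _ _).symm, ← Finset.sum_filter]
  symm
  refine Finset.sum_bij' (fun u _ => u + Pi.single j 1) (fun v _ => v - Pi.single j 1) ?_ ?_ ?_ ?_ ?_
  · intro u hu
    simp only [Finset.mem_piAntidiag, Finset.mem_filter] at hu ⊢
    refine ⟨⟨?_, by simp⟩, by simp⟩
    simp [Finset.sum_add_distrib, hu.1]
  · intro v hv
    simp only [Finset.mem_piAntidiag, Finset.mem_filter] at hv ⊢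
    refine ⟨?_, by simp⟩
    have h1 : v = (v - Pi.single j 1) + Pi.single j 1 := by
      ext i
      by_cases hi : i = j
      · subst hi
        have := hv.2
        simp
        omega
      · simp [hi]
    have h2 := hv.1.1
    rw [h1] at h2
    simp only [Pi.add_apply, Finset.sum_add_distrib] at h2
    simpa using h2
  · intro u hu
    simp
  · intro v hv
    simp only [Finset.mem_filter] at hv
    ext i
    by_cases hi : i = j
    · subst hi
      have := hv.2
      simp
      omega
    · simp [hi]
  · intro u hu
    simp only [add_tsub_cancel_right]
    congr 2
    simp [mul_add, Finset.sum_add_distrib, Pi.single_apply]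

theorem partialDeriv_hyperSum_succ (k : ℕ) (w : ℕ → ℂ) (x : Fin n → ℂ) (j : Fin n) :
    partialDeriv j (hyperSum a (k + 1) w) x = hyperSum a k (fun p => w (p + a j)) x := by
  rw [← sum_partialDeriv_dividedMonomial, partialDeriv]
  have hd : HasFDerivAt (hyperSum a (k + 1) w)
      (∑ u ∈ Finset.piAntidiag Finset.univ (k + 1),
        w (∑ i, a i * u i) • fderiv ℂ (dividedMonomial u) x) x := by
    refine HasFDerivAt.fun_sum fun u _ => ?_
    exact (((contDiff_dividedMonomial u (N := 1)).differentiable (by simp) x).hasFDerivAt).mul_const _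
  rw [hd.fderiv]
  simp [partialDeriv, mul_comm]

/-- This is the multinomial theorem. At a root of f it makes the sum vanish for k ≥ 1, which is the
cancellation behind the derivative rule for τ. -/
theorem hyperSum_pow (k : ℕ) (x : Fin n → ℂ) (t : ℂ) :
    hyperSum a k (fun p => t ^ p) x = (genericPoly a x).eval t ^ k / k.factorial := by
  rw [eval_genericPoly, Finset.sum_pow_eq_sum_piAntidiag, Finset.sum_div, hyperSum]
  refine Finset.sum_congr rfl fun u hu => ?_
  rw [Finset.mem_piAntidiag] at hu
  have h := Nat.multinomial_spec Finset.univ u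
  rw [hu.1] at h
  have h' : (∏ i, ((u i).factorial : ℂ)) * Nat.multinomial Finset.univ u = k.factorial := by
    exact_mod_cast h
  have h1 : (∏ i, ((u i).factorial : ℂ)) ≠ 0 :=
    Finset.prod_ne_zero_iff.2 fun i _ => by exact_mod_cast (u i).factorial_ne_zero
  have h2 : (Nat.multinomial Finset.univ u : ℂ) ≠ 0 := by
    exact_mod_cast (Nat.multinomial_pos _ _).ne'
  rw [← h', dividedMonomial, Finset.prod_div_distrib]
  simp only [mul_pow, Finset.prod_mul_distrib, ← pow_mul, Finset.prod_pow_eq_pow_sum]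
  field_simp

theorem mem_piAntidiag_iff_apply {k : ℕ} {i : ℤ} {u : Fin n → ℕ} :
    apply (curveMatrix a) u = ![(k : ℤ), i] ↔
      u ∈ Finset.piAntidiag Finset.univ k ∧ ((∑ j, a j * u j : ℕ) : ℤ) = i := by
  rw [Finset.mem_piAntidiag, funext_iff, Fin.forall_fin_two]
  simp [apply, curveMatrix, Matrix.mulVec, dotProduct]
  intro _
  exact_mod_cast Iff.rfl

theorem hyperPoly_natCast (k : ℕ) (i : ℤ) (x : Fin n → ℂ) :
    hyperPoly (curveMatrix a) ![(k : ℤ), i] x =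
      hyperSum a k (fun p => if (p : ℤ) = i then 1 else 0) x := by
  classical
  have hs : {u : Fin n → ℕ | apply (curveMatrix a) u = ![(k : ℤ), i]} =
      ↑((Finset.piAntidiag Finset.univ k).filter fun u : Fin n → ℕ =>
        ((∑ j, a j * u j : ℕ) : ℤ) = i) := by
    ext u
    simp only [Set.mem_ofPred_eq, Finset.coe_filter]
    exact mem_piAntidiag_iff_apply a
  rw [hyperPoly, hs, finsum_mem_coe_finset, Finset.sum_filter, hyperSum]
  exact Finset.sum_congr rfl fun u _ => by simp [dividedMonomial]

theorem hyperPoly_of_neg {k : ℤ} (hk : k < 0) (i : ℤ) (x : Fin n → ℂ) :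
    hyperPoly (curveMatrix a) ![k, i] x = 0 := by
  have hs : {u : Fin n → ℕ | apply (curveMatrix a) u = ![k, i]} = ∅ := by
    refine Set.eq_empty_of_forall_notMem fun u hu => ?_
    have h0 := congrFun hu 0
    simp [apply, curveMatrix, Matrix.mulVec, dotProduct] at h0
    have : (0 : ℤ) ≤ ∑ j, (u j : ℤ) := Finset.sum_nonneg fun _ _ => by positivity
    omega
  rw [hyperPoly, hs, finsum_mem_empty]

theorem contDiff_hyperPoly (k i : ℤ) {N : ℕ∞ω} :
    ContDiff ℂ N (hyperPoly (curveMatrix a) ![k, i]) := by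
  obtain hk | hk := lt_or_ge k 0
  · rw [funext (hyperPoly_of_neg a hk i)]
    exact contDiff_const
  · lift k to ℕ using hk
    rw [funext (hyperPoly_natCast a k i)]
    exact contDiff_hyperSum a k _

theorem partialDeriv_hyperPoly (k i : ℤ) (j : Fin n) (x : Fin n → ℂ) :
    partialDeriv j (hyperPoly (curveMatrix a) ![k, i]) x =
      hyperPoly (curveMatrix a) ![k - 1, i - a j] x := by
  obtain hk | hk := lt_or_ge k 0
  · rw [funext (hyperPoly_of_neg a hk i), hyperPoly_of_neg a (by omega)]
    simp [partialDeriv]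
  · lift k to ℕ using hk
    rw [funext (hyperPoly_natCast a k i)]
    cases k with
    | zero =>
      rw [funext (hyperSum_zero a _), hyperPoly_of_neg a (by simp)]
      simp [partialDeriv]
    | succ k =>
      have : ((k + 1 : ℕ) : ℤ) - 1 = k := by push_cast; ring
      rw [partialDeriv_hyperSum_succ, this, hyperPoly_natCast]
      congr 1
      ext p
      congr 1
      push_cast
      rw [eq_iff_iff]
      omega

end HyperSum

/-! ### Ladders and the toric equations -/

section Ladder

variable {n : ℕ} {a : Fin n → ℕ} {U : Set (Fin n → ℂ)}

/-- A family of smooth functions, indexed by exponents `(k, s) ∈ ℤ²`, on which the partial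
derivatives act by translation by the columns of the matrix of the monomial curve. -/
structure IsLadder (a : Fin n → ℕ) (U : Set (Fin n → ℂ)) (T : ℤ → ℤ → (Fin n → ℂ) → ℂ) : Prop where
  contDiffOn : ∀ k s, ContDiffOn ℂ ∞ (T k s) U
  partialDeriv : ∀ k s j, Set.EqOn (partialDeriv j (T k s)) (T (k - 1) (s - a j)) U

variable {T : ℤ → ℤ → (Fin n → ℂ) → ℂ}

theorem IsLadder.iterate_partialDeriv (hT : IsLadder a U T) (hUo : IsOpen U) (k s : ℤ) (j : Fin n)
    (i : ℕ) : Set.EqOn ((MonomialCurve.partialDeriv j)^[i] (T k s)) (T (k - i) (s - a j * i)) U := by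
  induction i with
  | zero => simp [Set.eqOn_refl]
  | succ i ih =>
    rw [Function.iterate_succ_apply']
    refine (eqOn_partialDeriv hUo ih j).trans ((hT.partialDeriv _ _ j).trans ?_)
    have e0 : k - (i : ℤ) - 1 = k - ((i + 1 : ℕ) : ℤ) := by push_cast; ring
    have e1 : s - (a j : ℤ) * i - a j = s - a j * ((i + 1 : ℕ) : ℤ) := by push_cast; ring
    rw [e0, e1]
    exact Set.eqOn_refl _ _

theorem IsLadder.monomialDeriv (hT : IsLadder a U T) (hUo : IsOpen U) (k s : ℤ) (u : Fin n → ℕ) :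
    Set.EqOn (monomialDeriv u (T k s)) (T (k - ∑ j, (u j : ℤ)) (s - ∑ j, (a j * u j : ℤ))) U := by
  rw [Fin.sum_univ_def, Fin.sum_univ_def, MonomialCurve.monomialDeriv]
  induction List.finRange n with
  | nil => simp [Set.eqOn_refl]
  | cons j t ih =>
    rw [List.foldr_cons]
    refine (eqOn_iterate_partialDeriv hUo ih j _).trans
      ((hT.iterate_partialDeriv hUo _ _ j _).trans ?_)
    have e0 : k - (t.map fun j => (u j : ℤ)).sum - u j =
        k - ((j :: t).map fun j => (u j : ℤ)).sum := by
      rw [List.map_cons, List.sum_cons]; ring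
    have e1 : s - (t.map fun j => (a j * u j : ℤ)).sum - a j * u j =
        s - ((j :: t).map fun j => (a j * u j : ℤ)).sum := by
      rw [List.map_cons, List.sum_cons]; ring
    rw [e0, e1]
    exact Set.eqOn_refl _ _

/-- The positive and negative parts of v have the same image under A, so both operators lead to the
same member of the ladder. -/
theorem IsLadder.monomialDeriv_eq (hT : IsLadder a U T) (hUo : IsOpen U) (k s : ℤ) {v : Fin n → ℤ}
    (hv : (curveMatrix a).mulVec v = 0) :
    Set.EqOn (MonomialCurve.monomialDeriv (fun j => (v j).toNat) (T k s))
      (MonomialCurve.monomialDeriv (fun j => (-v j).toNat) (T k s)) U := by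
  have h0 := congrFun hv 0
  have h1 := congrFun hv 1
  simp only [curveMatrix, Matrix.mulVec, dotProduct, Matrix.of_apply, Matrix.cons_val_zero,
    Matrix.cons_val_one, one_mul, Pi.zero_apply] at h0 h1
  have e0 : ∑ j, ((v j).toNat : ℤ) = ∑ j, ((-v j).toNat : ℤ) := by
    rw [← sub_eq_zero, ← Finset.sum_sub_distrib, ← h0]
    exact Finset.sum_congr rfl fun j _ => by omega
  have e1 : ∑ j, (a j * (v j).toNat : ℤ) = ∑ j, (a j * (-v j).toNat : ℤ) := by
    rw [← sub_eq_zero, ← Finset.sum_sub_distrib, ← h1]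
    refine Finset.sum_congr rfl fun j _ => ?_
    rw [← mul_sub]
    congr 1
    omega
  refine (hT.monomialDeriv hUo k s _).trans ?_
  rw [e0, e1]
  exact (hT.monomialDeriv hUo k s _).symm

theorem isLadder_hyperPoly (a : Fin n → ℕ) (U : Set (Fin n → ℂ)) :
    IsLadder a U fun k s => hyperPoly (curveMatrix a) ![k, s] where
  contDiffOn k s := (contDiff_hyperPoly a k s).contDiffOn
  partialDeriv k s j x _ := partialDeriv_hyperPoly a k s j x

end Ladder

/-! ### Power differences of two roots -/

section RootPair

variable {m : ℕ} {a : Fin (m + 2) → ℕ} {U : Set (Fin (m + 2) → ℂ)}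
  {R S l : (Fin (m + 2) → ℂ) → ℂ}

theorem contDiffOn_root (ha : StrictMono a) (hUo : IsOpen U) (hUS : U ⊆ (singularLocus a)ᶜ)
    (hR : DifferentiableOn ℂ R U) (hroot : ∀ x ∈ U, (genericPoly a x).eval (R x) = 0) :
    ContDiffOn ℂ ∞ R U := by
  refine contDiffOn_infty_of_partialDeriv hUo hR fun N hN j => ?_
  have : ContDiffOn ℂ N
      (fun x => -R x ^ a j / ∑ i, x i * (a i * R x ^ (a i - 1))) U := by
    refine (hN.pow _).neg.div (ContDiffOn.sum fun i _ => ?_) fun x hx => ?_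
    · exact (contDiff_apply ℂ ℂ i).contDiffOn.mul (contDiffOn_const.mul (hN.pow _))
    · rw [← eval_derivative_genericPoly]
      exact eval_derivative_ne_zero ha (hUS hx) (hroot x hx)
  refine this.congr fun x hx => ?_
  rw [partialDeriv_root (hR.differentiableAt (hUo.mem_nhds hx)) ?_
    (eval_derivative_ne_zero ha (hUS hx) (hroot x hx)), eval_derivative_genericPoly]
  filter_upwards [hUo.mem_nhds hx] with y hy using hroot y hy

/-- Two roots `R`, `S` of `f(x; t)` on `U` together with a branch `l` of `log (R / S)`. -/
structure IsRootPair (a : Fin (m + 2) → ℕ) (U : Set (Fin (m + 2) → ℂ))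
    (R S l : (Fin (m + 2) → ℂ) → ℂ) : Prop where
  strictMono : StrictMono a
  zero : a 0 = 0
  isOpen : IsOpen U
  subset : U ⊆ (singularLocus a)ᶜ
  diff_fst : DifferentiableOn ℂ R U
  diff_snd : DifferentiableOn ℂ S U
  diff_log : DifferentiableOn ℂ l U
  root_fst : ∀ x ∈ U, (genericPoly a x).eval (R x) = 0
  root_snd : ∀ x ∈ U, (genericPoly a x).eval (S x) = 0
  exp_log : ∀ x ∈ U, Complex.exp (l x) = R x / S x

/-- The function `(R ^ p - S ^ p) / p`, with the limiting value `log (R / S)` for `p = 0`. -/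
noncomputable def powDiff (R S l : (Fin (m + 2) → ℂ) → ℂ) (p : ℤ) (x : Fin (m + 2) → ℂ) : ℂ :=
  if p = 0 then l x else (R x ^ p - S x ^ p) / p

namespace IsRootPair

variable (h : IsRootPair a U R S l)
include h

theorem fst_ne_zero {x} (hx : x ∈ U) : R x ≠ 0 :=
  root_ne_zero h.strictMono (h.subset hx) h.zero (h.root_fst x hx)

theorem snd_ne_zero {x} (hx : x ∈ U) : S x ≠ 0 :=
  root_ne_zero h.strictMono (h.subset hx) h.zero (h.root_snd x hx)

/-- The division by p makes the formula uniform in p. For p = 0 it comes from differentiating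
exp(l)·S = R; no explicit logarithm is needed. -/
theorem hasFDerivAt_powDiff {x} (hx : x ∈ U) (p : ℤ) :
    HasFDerivAt (powDiff R S l p)
      (R x ^ (p - 1) • fderiv ℂ R x - S x ^ (p - 1) • fderiv ℂ S x) x := by
  have hR0 := h.fst_ne_zero hx
  have hS0 := h.snd_ne_zero hx
  have hR := (h.diff_fst.differentiableAt (h.isOpen.mem_nhds hx)).hasFDerivAt
  have hS := (h.diff_snd.differentiableAt (h.isOpen.mem_nhds hx)).hasFDerivAt
  by_cases hp : p = 0
  · subst hp
    have hl := (h.diff_log.differentiableAt (h.isOpen.mem_nhds hx)).hasFDerivAt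
    have e1 := hl.cexp.mul hS
    have e2 : HasFDerivAt (fun y => Complex.exp (l y) * S y) (fderiv ℂ R x) x := by
      refine hR.congr_of_eventuallyEq ?_
      filter_upwards [h.isOpen.mem_nhds hx] with y hy
      rw [h.exp_log y hy, div_mul_cancel₀ _ (h.snd_ne_zero hy)]
    have e3 := e1.unique e2
    have e4 : powDiff R S l 0 = l := by ext y; simp [powDiff]
    rw [e4]
    convert hl using 1
    rw [← e3, h.exp_log x hx]
    ext v
    simp only [zero_sub, zpow_neg, zpow_one, smul_add, smul_smul, sub_apply,
      add_apply, smul_apply, smul_eq_mul]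
    field_simp
    ring
  · have hp' : (p : ℂ) ≠ 0 := by exact_mod_cast hp
    have e1 := (hasDerivAt_zpow p (R x) (Or.inl hR0)).comp_hasFDerivAt x hR
    have e2 := (hasDerivAt_zpow p (S x) (Or.inl hS0)).comp_hasFDerivAt x hS
    have e3 := (e1.sub e2).mul_const (p : ℂ)⁻¹
    have e4 : powDiff R S l p = fun y => (R y ^ p - S y ^ p) * (p : ℂ)⁻¹ := by
      ext y
      simp [powDiff, hp, div_eq_mul_inv]
    rw [e4]
    refine e3.congr_fderiv (ContinuousLinearMap.ext fun v => ?_)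
    simp only [sub_apply, smul_apply, smul_eq_mul]
    field_simp

theorem eventually_root_fst {x} (hx : x ∈ U) : ∀ᶠ y in 𝓝 x, (genericPoly a y).eval (R y) = 0 := by
  filter_upwards [h.isOpen.mem_nhds hx] with y hy using h.root_fst y hy

theorem symm : IsRootPair a U S R (fun x => -l x) where
  strictMono := h.strictMono
  zero := h.zero
  isOpen := h.isOpen
  subset := h.subset
  diff_fst := h.diff_snd
  diff_snd := h.diff_fst
  diff_log := h.diff_log.neg
  root_fst := h.root_snd
  root_snd := h.root_fst
  exp_log x hx := by rw [Complex.exp_neg, h.exp_log x hx, inv_div]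

theorem partialDeriv_fst {x} (hx : x ∈ U) (j : Fin (m + 2)) :
    partialDeriv j R x = -R x ^ a j / (genericPoly a x).derivative.eval (R x) :=
  partialDeriv_root (h.diff_fst.differentiableAt (h.isOpen.mem_nhds hx)) (h.eventually_root_fst hx)
    (eval_derivative_ne_zero h.strictMono (h.subset hx) (h.root_fst x hx)) j

theorem partialDeriv_snd {x} (hx : x ∈ U) (j : Fin (m + 2)) :
    partialDeriv j S x = -S x ^ a j / (genericPoly a x).derivative.eval (S x) :=
  h.symm.partialDeriv_fst hx j

theorem partialDeriv_powDiff {x} (hx : x ∈ U) (p : ℤ) (j : Fin (m + 2)) :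
    partialDeriv j (powDiff R S l p) x =
      R x ^ (p - 1) * partialDeriv j R x - S x ^ (p - 1) * partialDeriv j S x := by
  rw [partialDeriv, (h.hasFDerivAt_powDiff hx p).fderiv]
  rfl

/-- In this form p and j enter only through p + a_j. -/
theorem partialDeriv_powDiff_eq {x} (hx : x ∈ U) (p : ℤ) (j : Fin (m + 2)) :
    partialDeriv j (powDiff R S l p) x =
      -(R x ^ (p - 1 + a j) / (genericPoly a x).derivative.eval (R x)) +
        S x ^ (p - 1 + a j) / (genericPoly a x).derivative.eval (S x) := by
  rw [h.partialDeriv_powDiff hx, h.partialDeriv_fst hx, h.partialDeriv_snd hx,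
    zpow_add₀ (h.fst_ne_zero hx), zpow_add₀ (h.snd_ne_zero hx), zpow_natCast, zpow_natCast]
  ring

theorem contDiffOn_fst : ContDiffOn ℂ ∞ R U :=
  contDiffOn_root h.strictMono h.isOpen h.subset h.diff_fst h.root_fst

theorem contDiffOn_snd : ContDiffOn ℂ ∞ S U := h.symm.contDiffOn_fst

theorem contDiffOn_powDiff (p : ℤ) : ContDiffOn ℂ ∞ (powDiff R S l p) U := by
  refine contDiffOn_infty_of_partialDeriv h.isOpen
    (fun x hx => (h.hasFDerivAt_powDiff hx p).differentiableAt.differentiableWithinAt)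
    fun N _ j => ?_
  have : ContDiffOn ℂ ∞ (fun x =>
      R x ^ (p - 1) * partialDeriv j R x - S x ^ (p - 1) * partialDeriv j S x) U :=
    ((contDiffOn_zpow h.contDiffOn_fst (fun _ => h.fst_ne_zero) _).mul
      (contDiffOn_partialDeriv h.isOpen h.contDiffOn_fst j)).sub
    ((contDiffOn_zpow h.contDiffOn_snd (fun _ => h.snd_ne_zero) _).mul
      (contDiffOn_partialDeriv h.isOpen h.contDiffOn_snd j))
  exact (this.of_le (by exact_mod_cast le_top)).congr fun x hx => h.partialDeriv_powDiff hx p j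

/-- All first derivatives of the power differences are derivatives with respect to `x₀`. -/
theorem partialDeriv_powDiff_eq_partialDeriv_zero (p : ℤ) (j : Fin (m + 2)) :
    Set.EqOn (partialDeriv j (powDiff R S l p)) (partialDeriv 0 (powDiff R S l (p + a j))) U := by
  intro x hx
  have e : p + a j - 1 + ((0 : ℕ) : ℤ) = p - 1 + a j := by push_cast; ring
  rw [h.partialDeriv_powDiff_eq hx, h.partialDeriv_powDiff_eq hx, h.zero, e]

theorem sum_mul_partialDeriv_powDiff {x} (hx : x ∈ U) (p : ℤ) :
    ∑ j, x j * partialDeriv j (powDiff R S l p) x = 0 := by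
  have hR := h.root_fst x hx
  have hS := h.root_snd x hx
  rw [eval_genericPoly] at hR hS
  have e : ∀ j, x j * partialDeriv j (powDiff R S l p) x =
      -(R x ^ (p - 1) / (genericPoly a x).derivative.eval (R x)) * (x j * R x ^ a j) +
        S x ^ (p - 1) / (genericPoly a x).derivative.eval (S x) * (x j * S x ^ a j) := by
    intro j
    rw [h.partialDeriv_powDiff hx, h.partialDeriv_fst hx, h.partialDeriv_snd hx]
    ring
  simp only [e, Finset.sum_add_distrib, ← Finset.mul_sum, hR, hS, mul_zero, add_zero]

/-- The weighted sum Σ a_j x_j t^{a_j} equals t f'(t), which cancels the denominator f' in the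
derivative of each root. -/
theorem sum_mul_mul_partialDeriv_powDiff {x} (hx : x ∈ U) (p : ℤ) :
    ∑ j, (a j : ℂ) * x j * partialDeriv j (powDiff R S l p) x = -p * powDiff R S l p x := by
  have hR0 := h.fst_ne_zero hx
  have hS0 := h.snd_ne_zero hx
  have hR := eval_derivative_ne_zero h.strictMono (h.subset hx) (h.root_fst x hx)
  have hS := eval_derivative_ne_zero h.strictMono (h.subset hx) (h.root_snd x hx)
  have hsum : ∀ t : ℂ, t ≠ 0 → ∑ j, (a j : ℂ) * x j * t ^ a j =
      t * (genericPoly a x).derivative.eval t := by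
    intro t ht
    rw [eval_derivative_genericPoly, Finset.mul_sum]
    refine Finset.sum_congr rfl fun j _ => ?_
    rcases Nat.eq_zero_or_pos (a j) with h0 | h0
    · simp [h0]
    · obtain ⟨k, hk⟩ := Nat.exists_eq_succ_of_ne_zero h0.ne'
      simp only [hk, Nat.succ_eq_add_one, Nat.add_sub_cancel]
      ring
  have e : ∀ j, (a j : ℂ) * x j * partialDeriv j (powDiff R S l p) x =
      -(R x ^ (p - 1) / (genericPoly a x).derivative.eval (R x)) * ((a j : ℂ) * x j * R x ^ a j) +
        S x ^ (p - 1) / (genericPoly a x).derivative.eval (S x) *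
          ((a j : ℂ) * x j * S x ^ a j) := by
    intro j
    rw [h.partialDeriv_powDiff hx, h.partialDeriv_fst hx, h.partialDeriv_snd hx]
    ring
  simp only [e, Finset.sum_add_distrib, ← Finset.mul_sum, hsum _ hR0, hsum _ hS0]
  have e1 : -(R x ^ (p - 1) / (genericPoly a x).derivative.eval (R x)) *
      (R x * (genericPoly a x).derivative.eval (R x)) = -R x ^ p := by
    rw [zpow_sub_one₀ hR0]
    field_simp
  have e2 : S x ^ (p - 1) / (genericPoly a x).derivative.eval (S x) *
      (S x * (genericPoly a x).derivative.eval (S x)) = S x ^ p := by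
    rw [zpow_sub_one₀ hS0]
    field_simp
  rw [e1, e2, powDiff]
  split_ifs with hp
  · simp [hp]
  · have hp' : (p : ℂ) ≠ 0 := by exact_mod_cast hp
    field_simp
    ring

end IsRootPair

end RootPair

/-! ### From ladders to hypergeometric functions; the polynomial solution -/

section Hypergeometric

variable {n : ℕ} {a : Fin n → ℕ} {U : Set (Fin n → ℂ)}

theorem IsLadder.isHypergeometric {T : ℤ → ℤ → (Fin n → ℂ) → ℂ} (hT : IsLadder a U T)
    (hUo : IsOpen U) {α : Fin 2 → ℤ} {g : U → ℂ} (hg : Set.EqOn (zeroExt g) (T (α 0) (α 1)) U)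
    (h0 : ∀ x ∈ U, ∑ j, x j * MonomialCurve.partialDeriv j (T (α 0) (α 1)) x =
      α 0 * T (α 0) (α 1) x)
    (h1 : ∀ x ∈ U, ∑ j, (a j : ℂ) * x j * MonomialCurve.partialDeriv j (T (α 0) (α 1)) x =
      α 1 * T (α 0) (α 1) x) : IsHypergeometric (curveMatrix a) α g := by
  refine ⟨((hT.contDiffOn _ _).differentiableOn (by simp)).congr hg, fun v hv x hx => ?_,
    Fin.forall_fin_two.2 ⟨fun x hx => ?_, fun x hx => ?_⟩⟩
  · rw [eqOn_monomialDeriv hUo hg _ hx, eqOn_monomialDeriv hUo hg _ hx]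
    exact hT.monomialDeriv_eq hUo _ _ hv hx
  · rw [hg hx, ← h0 x hx]
    refine Finset.sum_congr rfl fun j _ => ?_
    rw [eqOn_partialDeriv hUo hg j hx]
    simp [curveMatrix]
  · rw [hg hx, ← h1 x hx]
    refine Finset.sum_congr rfl fun j _ => ?_
    rw [eqOn_partialDeriv hUo hg j hx]
    simp [curveMatrix]

theorem sum_mul_partialDeriv_dividedMonomial {k : ℕ} {u : Fin n → ℕ}
    (hu : u ∈ Finset.piAntidiag Finset.univ k) (x : Fin n → ℂ) :
    ∑ j, x j * partialDeriv j (dividedMonomial u) x = k * dividedMonomial u x := by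
  rw [Finset.mem_piAntidiag] at hu
  simp only [mul_partialDeriv_dividedMonomial, ← Finset.sum_mul, ← hu.1]
  push_cast
  rfl

theorem sum_mul_mul_partialDeriv_dividedMonomial (a : Fin n → ℕ) (u : Fin n → ℕ)
    (x : Fin n → ℂ) :
    ∑ j, (a j : ℂ) * x j * partialDeriv j (dividedMonomial u) x =
      (∑ j, a j * u j : ℕ) * dividedMonomial u x := by
  simp only [mul_assoc, mul_partialDeriv_dividedMonomial]
  push_cast
  rw [Finset.sum_mul]
  exact Finset.sum_congr rfl fun j _ => by ring

/-- The product rule for sums `∑ w_u x^u / u!` with variable weights. -/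
theorem partialDeriv_hyperSum_family (k : ℕ) {w : ℕ → (Fin n → ℂ) → ℂ} {x : Fin n → ℂ}
    (hw : ∀ p, DifferentiableAt ℂ (w p) x) (j : Fin n) :
    partialDeriv j (fun y => hyperSum a k (fun p => w p y) y) x =
      ∑ u ∈ Finset.piAntidiag Finset.univ k,
        (partialDeriv j (dividedMonomial u) x * w (∑ i, a i * u i) x +
          dividedMonomial u x * partialDeriv j (w (∑ i, a i * u i)) x) := by
  have hd : HasFDerivAt (fun y => hyperSum a k (fun p => w p y) y)
      (∑ u ∈ Finset.piAntidiag Finset.univ k,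
        (dividedMonomial u x • fderiv ℂ (w (∑ i, a i * u i)) x +
          w (∑ i, a i * u i) x • fderiv ℂ (dividedMonomial u) x)) x := by
    refine HasFDerivAt.fun_sum fun u _ => ?_
    exact (((contDiff_dividedMonomial u (N := 1)).differentiable (by simp) x).hasFDerivAt).mul
      (hw _).hasFDerivAt
  rw [partialDeriv, hd.fderiv, sum_apply]
  refine Finset.sum_congr rfl fun u _ => ?_
  simp only [add_apply, smul_apply, smul_eq_mul, partialDeriv]
  ring

theorem isHypergeometric_hyperPoly (hUo : IsOpen U) {α : Fin 2 → ℤ} (hα : 0 ≤ α 0) :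
    IsHypergeometric (curveMatrix a) α (fun x : U => hyperPoly (curveMatrix a) α x) := by
  have hα' : α = ![α 0, α 1] := by
    ext i
    fin_cases i <;> rfl
  obtain ⟨k, hk⟩ := Int.eq_ofNat_of_zero_le hα
  have hd : ∀ j x, partialDeriv j (hyperPoly (curveMatrix a) ![α 0, α 1]) x =
      ∑ u ∈ Finset.piAntidiag Finset.univ k, partialDeriv j (dividedMonomial u) x *
        (if ((∑ i, a i * u i : ℕ) : ℤ) = α 1 then 1 else 0) := by
    intro j x
    rw [hk, funext (hyperPoly_natCast a k (α 1))]
    have := partialDeriv_hyperSum_family (a := a) k (x := x)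
      (w := fun p _ => if (p : ℤ) = α 1 then 1 else 0) (fun p => differentiableAt_const _) j
    rw [this]
    refine Finset.sum_congr rfl fun u _ => ?_
    simp [partialDeriv]
  refine (isLadder_hyperPoly a U).isHypergeometric hUo (fun x hx => ?_) (fun x _ => ?_)
    fun x _ => ?_
  · rw [← hα']
    exact zeroExt_coe _ (⟨x, hx⟩ : U)
  · simp only [hd, Finset.mul_sum]
    rw [Finset.sum_comm, hk, hyperPoly_natCast, hyperSum, Finset.mul_sum]
    refine Finset.sum_congr rfl fun u hu => ?_
    simp only [← mul_assoc, ← Finset.sum_mul, sum_mul_partialDeriv_dividedMonomial hu]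
    simp
  · simp only [hd, Finset.mul_sum]
    rw [Finset.sum_comm, hk, hyperPoly_natCast, hyperSum, Finset.mul_sum]
    refine Finset.sum_congr rfl fun u hu => ?_
    simp only [← mul_assoc, ← Finset.sum_mul]
    simp only [sum_mul_mul_partialDeriv_dividedMonomial]
    split_ifs with h
    · rw [← h]
      push_cast
      ring
    · simp

end Hypergeometric

/-! ### The functions τ form a ladder -/

section Tau

variable {m : ℕ} {a : Fin (m + 2) → ℕ} {U : Set (Fin (m + 2) → ℂ)}
  {R S l : (Fin (m + 2) → ℂ) → ℂ}

/-- The function `τ` for the exponent `(k, s)`, as a sum over monomials. -/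
noncomputable def tauSum (a : Fin (m + 2) → ℕ) (R S l : (Fin (m + 2) → ℂ) → ℂ) (k : ℕ) (s : ℤ)
    (x : Fin (m + 2) → ℂ) : ℂ :=
  hyperSum a k (fun p => powDiff R S l (p - s) x) x

theorem tauSum_zero (a : Fin (m + 2) → ℕ) (R S l : (Fin (m + 2) → ℂ) → ℂ) (s : ℤ) :
    tauSum a R S l 0 s = powDiff R S l (-s) := by
  ext x
  rw [tauSum, hyperSum_zero]
  simp

/-- The extension of `tauSum` to all exponents `(k, s) ∈ ℤ²`. -/
noncomputable def tauLadder (a : Fin (m + 2) → ℕ) (R S l : (Fin (m + 2) → ℂ) → ℂ) :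
    ℤ → ℤ → (Fin (m + 2) → ℂ) → ℂ
  | .ofNat k, s => tauSum a R S l k s
  -- Because a_0 = 0, the operator ∂_0 lowers k and keeps s, so the ladder rule forces this choice
  -- below level 0.
  | .negSucc k, s => (partialDeriv 0)^[k + 1] (powDiff R S l (-s))

namespace IsRootPair

variable (h : IsRootPair a U R S l)
include h

theorem contDiffOn_tauSum (k : ℕ) (s : ℤ) : ContDiffOn ℂ ∞ (tauSum a R S l k s) U :=
  ContDiffOn.sum fun u _ => (contDiff_dividedMonomial u).contDiffOn.mul (h.contDiffOn_powDiff _)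

theorem partialDeriv_tauSum {x} (hx : x ∈ U) (k : ℕ) (s : ℤ) (j : Fin (m + 2)) :
    partialDeriv j (tauSum a R S l k s) x =
      ∑ u ∈ Finset.piAntidiag Finset.univ k,
        (partialDeriv j (dividedMonomial u) x *
          powDiff R S l ((∑ i, a i * u i : ℕ) - s) x +
          dividedMonomial u x *
            partialDeriv j (powDiff R S l ((∑ i, a i * u i : ℕ) - s)) x) :=
  partialDeriv_hyperSum_family (w := fun p => powDiff R S l (p - s)) k
    (fun _ => (h.hasFDerivAt_powDiff hx _).differentiableAt) j

/-- The terms where ∂_j hits the power differences add up to multiples of f(R)^{k+1} and f(S)^{k+1},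
both zero; the positive level k + 1 is essential. Only the shifted monomials survive. -/
theorem partialDeriv_tauSum_succ {x} (hx : x ∈ U) (k : ℕ) (s : ℤ) (j : Fin (m + 2)) :
    partialDeriv j (tauSum a R S l (k + 1) s) x = tauSum a R S l k (s - a j) x := by
  rw [h.partialDeriv_tauSum hx, Finset.sum_add_distrib,
    sum_partialDeriv_dividedMonomial a k (fun p => powDiff R S l (p - s) x)]
  have hz : ∀ (V : (Fin (m + 2) → ℂ) → ℂ), V x ≠ 0 → (genericPoly a x).eval (V x) = 0 →
      ∑ u ∈ Finset.piAntidiag Finset.univ (k + 1),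
        dividedMonomial u x * (V x ^ (((∑ i, a i * u i : ℕ) : ℤ) - s - 1)) = 0 := by
    intro V hV0 hV
    have := hyperSum_pow a (k + 1) x (V x)
    rw [hV, zero_pow k.succ_ne_zero, zero_div, hyperSum] at this
    rw [← zero_mul (V x ^ (-s - 1)), ← this, Finset.sum_mul]
    refine Finset.sum_congr rfl fun u _ => ?_
    rw [sub_sub, sub_eq_add_neg, zpow_add₀ hV0, zpow_natCast, mul_assoc]
    congr 3
    ring
  have e : ∑ u ∈ Finset.piAntidiag Finset.univ (k + 1), dividedMonomial u x *
      partialDeriv j (powDiff R S l ((∑ i, a i * u i : ℕ) - s)) x = 0 := by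
    simp only [h.partialDeriv_powDiff hx, mul_sub, Finset.sum_sub_distrib, ← mul_assoc,
      ← Finset.sum_mul]
    rw [hz R (h.fst_ne_zero hx) (h.root_fst x hx), hz S (h.snd_ne_zero hx) (h.root_snd x hx)]
    simp
  rw [e, add_zero, tauSum]
  congr 1
  ext p
  congr 1
  push_cast
  ring

theorem isLadder_tauLadder : IsLadder a U (tauLadder a R S l) where
  contDiffOn k s := by
    cases k with
    | ofNat k => exact h.contDiffOn_tauSum k s
    | negSucc k => exact contDiffOn_iterate_partialDeriv h.isOpen (h.contDiffOn_powDiff _) 0 _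
  partialDeriv k s j := by
    have e : -s + (a j : ℤ) = -(s - a j) := by ring
    cases k with
    | ofNat k =>
      cases k with
      | zero =>
        change Set.EqOn (MonomialCurve.partialDeriv j (tauSum a R S l 0 s))
          ((MonomialCurve.partialDeriv 0)^[0 + 1] (powDiff R S l (-(s - a j)))) U
        rw [tauSum_zero, ← e]
        exact h.partialDeriv_powDiff_eq_partialDeriv_zero _ j
      | succ k =>
        have : (Int.ofNat (k + 1)) - 1 = Int.ofNat k := by simp
        rw [this]
        exact fun x hx => h.partialDeriv_tauSum_succ hx k s j
    | negSucc k =>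
      have : Int.negSucc k - 1 = Int.negSucc (k + 1) := by omega
      rw [this]
      change Set.EqOn (MonomialCurve.partialDeriv j
        ((MonomialCurve.partialDeriv 0)^[k + 1] (powDiff R S l (-s))))
          ((MonomialCurve.partialDeriv 0)^[k + 1 + 1] (powDiff R S l (-(s - a j)))) U
      refine (partialDeriv_iterate_comm h.isOpen (h.contDiffOn_powDiff _) j 0 _).trans ?_
      rw [Function.iterate_succ_apply _ (k + 1), ← e]
      exact eqOn_iterate_partialDeriv h.isOpen
        (h.partialDeriv_powDiff_eq_partialDeriv_zero _ j) 0 _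

theorem sum_mul_partialDeriv_tauSum {x} (hx : x ∈ U) (k : ℕ) (s : ℤ) :
    ∑ j, x j * partialDeriv j (tauSum a R S l k s) x = k * tauSum a R S l k s x := by
  simp only [h.partialDeriv_tauSum hx, Finset.mul_sum]
  rw [Finset.sum_comm, tauSum, hyperSum, Finset.mul_sum]
  refine Finset.sum_congr rfl fun u hu => ?_
  simp only [mul_add, Finset.sum_add_distrib, ← mul_assoc, ← Finset.sum_mul,
    sum_mul_partialDeriv_dividedMonomial hu]
  rw [add_eq_left]
  simp only [mul_comm _ (dividedMonomial u x), mul_assoc, ← Finset.mul_sum,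
    h.sum_mul_partialDeriv_powDiff hx, mul_zero]

theorem sum_mul_mul_partialDeriv_tauSum {x} (hx : x ∈ U) (k : ℕ) (s : ℤ) :
    ∑ j, (a j : ℂ) * x j * partialDeriv j (tauSum a R S l k s) x = s * tauSum a R S l k s x := by
  simp only [h.partialDeriv_tauSum hx, Finset.mul_sum]
  rw [Finset.sum_comm, tauSum, hyperSum, Finset.mul_sum]
  refine Finset.sum_congr rfl fun u hu => ?_
  have e : ∀ j, (a j : ℂ) * x j * (partialDeriv j (dividedMonomial u) x *
      powDiff R S l ((∑ i, a i * u i : ℕ) - s) x + dividedMonomial u x *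
        partialDeriv j (powDiff R S l ((∑ i, a i * u i : ℕ) - s)) x) =
      (a j : ℂ) * x j * partialDeriv j (dividedMonomial u) x *
        powDiff R S l ((∑ i, a i * u i : ℕ) - s) x +
      dividedMonomial u x * ((a j : ℂ) * x j *
        partialDeriv j (powDiff R S l ((∑ i, a i * u i : ℕ) - s)) x) := fun j => by ring
  rw [Finset.sum_congr rfl fun j _ => e j, Finset.sum_add_distrib, ← Finset.sum_mul,
    ← Finset.mul_sum, h.sum_mul_mul_partialDeriv_powDiff hx,
    sum_mul_mul_partialDeriv_dividedMonomial]
  push_cast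
  ring

end IsRootPair

/-- Collect the u with |u| = k according to i = a·u, which lies between 0 and dk. The fibre over i
contributes Φ(k, i) times the power difference of index i - s. -/
theorem tau_eq_tauSum (ha : StrictMono a) {k : ℕ} {α : Fin 2 → ℤ} (hk : α 0 = k)
    (ρ ρ' l : U → ℂ) (x : U) :
    tau a α ρ ρ' l x =
      tauSum a (zeroExt ρ) (zeroExt ρ') (zeroExt l) k (α 1) (x : Fin (m + 2) → ℂ) := by
  classical
  have hα' : α = ![(k : ℤ), α 1] := by
    ext i
    fin_cases i
    · exact hk
    · rfl
  set s := α 1 with hs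
  set D := Finset.Icc (0 : ℤ) ((a (Fin.last (m + 1)) : ℤ) * α 0) with hD
  set w : ℤ → ℂ := fun i => powDiff (zeroExt ρ) (zeroExt ρ') (zeroExt l) (i - s) x with hw
  have hmap : ∀ u ∈ Finset.piAntidiag (Finset.univ : Finset (Fin (m + 2))) k,
      ((∑ j, a j * u j : ℕ) : ℤ) ∈ D := by
    intro u hu
    rw [Finset.mem_piAntidiag] at hu
    rw [hD, Finset.mem_Icc, hk]
    refine ⟨by positivity, ?_⟩
    rw [← hu.1]
    norm_cast
    rw [Finset.mul_sum]
    exact Finset.sum_le_sum fun j _ => Nat.mul_le_mul_right _ (ha.monotone (Fin.le_last j))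
  have hpoly : ∀ i : ℤ, hyperPoly (curveMatrix a) ![(k : ℤ), i] x =
      ∑ u ∈ Finset.piAntidiag Finset.univ k with ((∑ j, a j * u j : ℕ) : ℤ) = i,
        dividedMonomial u (x : Fin (m + 2) → ℂ) := by
    intro i
    rw [hyperPoly_natCast, hyperSum, Finset.sum_filter]
    exact Finset.sum_congr rfl fun u _ => by simp
  have hsum : tauSum a (zeroExt ρ) (zeroExt ρ') (zeroExt l) k s (x : Fin (m + 2) → ℂ) =
      ∑ i ∈ D, hyperPoly (curveMatrix a) ![(k : ℤ), i] x * w i := by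
    rw [tauSum, hyperSum, ← Finset.sum_fiberwise_of_maps_to hmap]
    refine Finset.sum_congr rfl fun i _ => ?_
    rw [hpoly, Finset.sum_mul]
    refine Finset.sum_congr rfl fun u hu => ?_
    rw [(Finset.mem_filter.1 hu).2]
  have hs0 : w s = l x := by simp [hw, powDiff, zeroExt_coe]
  have hsplit : ∑ i ∈ D, hyperPoly (curveMatrix a) ![(k : ℤ), i] x * w i =
      ∑ i ∈ D.erase s, hyperPoly (curveMatrix a) ![(k : ℤ), i] x * w i +
        hyperPoly (curveMatrix a) ![(k : ℤ), s] x * w s := by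
    by_cases hsD : s ∈ D
    · rw [Finset.sum_erase_add _ _ hsD]
    -- For s outside the range, Φ(α) is an empty sum, so the logarithmic term is zero and adding it
    -- is harmless.
    · rw [Finset.erase_eq_of_notMem hsD, hpoly s, Finset.filter_eq_empty_iff.2, Finset.sum_empty,
        zero_mul, add_zero]
      intro u hu h
      exact hsD (h ▸ hmap u hu)
  rw [hsum, hsplit, hs0, tau, ← hs, ← hD, hk]
  congr 1
  · refine Finset.sum_congr rfl fun i hi => ?_
    have : i - s ≠ 0 := sub_ne_zero.2 (Finset.ne_of_mem_erase hi)
    simp only [hw, powDiff, this, if_false, zeroExt_coe]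
    push_cast
    rfl
  · rw [← hα']

theorem isHypergeometric_tau {α : Fin 2 → ℤ} (hα : 0 ≤ α 0) {ρ ρ' l : U → ℂ}
    (h : IsRootPair a U (zeroExt ρ) (zeroExt ρ') (zeroExt l)) :
    IsHypergeometric (curveMatrix a) α (tau a α ρ ρ' l) := by
  obtain ⟨k, hk⟩ := Int.eq_ofNat_of_zero_le hα
  have hT : tauLadder a (zeroExt ρ) (zeroExt ρ') (zeroExt l) (α 0) (α 1) =
      tauSum a (zeroExt ρ) (zeroExt ρ') (zeroExt l) k (α 1) := by rw [hk]; rfl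
  refine h.isLadder_tauLadder.isHypergeometric h.isOpen (fun x hx => ?_) (fun x hx => ?_)
    fun x hx => ?_
  · rw [hT, ← tau_eq_tauSum h.strictMono hk ρ ρ' l ⟨x, hx⟩]
    exact zeroExt_coe _ (⟨x, hx⟩ : U)
  · rw [hT, hk]
    exact_mod_cast h.sum_mul_partialDeriv_tauSum hx k (α 1)
  · rw [hT]
    exact h.sum_mul_mul_partialDeriv_tauSum hx k (α 1)

end Tau

/-! ### Consecutive integers in the numerical semigroup -/

section Semigroup

variable {m : ℕ} {a : Fin (m + 2) → ℕ}

theorem exists_sum_eq_of_gcd_eq_one (hgcd : Finset.univ.gcd a = 1) :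
    ∃ C, ∀ s ≥ C, ∃ u : Fin (m + 2) → ℕ, ∑ j, a j * u j = s := by
  obtain ⟨C, hC⟩ := Nat.exists_mem_closure_of_ge (Set.range a)
  have hg : Nat.setGcd (Set.range a) = 1 := by
    rw [← Nat.dvd_one, ← hgcd]
    exact Finset.dvd_gcd fun j _ => Nat.setGcd_dvd_of_mem ⟨j, rfl⟩
  refine ⟨C, fun s hs => ?_⟩
  have := hC s hs (by simp [hg])
  obtain ⟨u, hu⟩ := AddSubmonoid.mem_closure_range_iff_of_fintype.1 this
  exact ⟨u, by simpa [mul_comm] using hu.symm⟩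

/-- Arbitrarily many consecutive lattice points of one level lie in the semigroup of the
monomial curve. -/
theorem exists_level_of_gcd_eq_one (ha0 : a 0 = 0) (hgcd : Finset.univ.gcd a = 1) (d : ℕ) :
    ∃ C K : ℕ, 0 < C ∧ ∀ p < d, ∃ u : Fin (m + 2) → ℕ,
      ∑ j, u j = K + 1 ∧ ∑ j, a j * u j = C + p := by
  obtain ⟨C, hC⟩ := exists_sum_eq_of_gcd_eq_one hgcd
  choose u hu using fun p : ℕ => hC (C + 1 + p) (by omega)
  refine ⟨C + 1, ∑ p ∈ Finset.range d, ∑ j, u p j, by omega, fun p hp => ?_⟩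
  have hle : ∑ j, u p j ≤ ∑ p ∈ Finset.range d, ∑ j, u p j :=
    Finset.single_le_sum (f := fun p => ∑ j, u p j) (fun _ _ => Nat.zero_le _)
      (Finset.mem_range.2 hp)
  obtain ⟨e, he⟩ := Nat.exists_eq_add_of_le hle
  -- Padding at index 0 brings all the vectors to the common size K + 1 and leaves a·u unchanged,
  -- since a_0 = 0.
  refine ⟨u p + Pi.single 0 (e + 1), ?_, ?_⟩
  · simp [Finset.sum_add_distrib, he, add_assoc]
  · rw [← hu p]
    simp [mul_add, Finset.sum_add_distrib, Pi.single_apply, ha0]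

end Semigroup

/-! ### Polynomial dependence on the constant coefficient -/

section Line

theorem exists_derivative_eq (q : ℂ[X]) : ∃ Q : ℂ[X], derivative Q = q := by
  induction q using Polynomial.induction_on' with
  | add p q hp hq =>
    obtain ⟨P, rfl⟩ := hp
    obtain ⟨Q, rfl⟩ := hq
    exact ⟨P + Q, derivative_add⟩
  | monomial k c =>
    refine ⟨monomial (k + 1) (c / (k + 1)), ?_⟩
    rw [derivative_monomial]
    have : (k + 1 : ℂ) ≠ 0 := by exact_mod_cast k.succ_ne_zero
    congr 1
    push_cast
    field_simp

variable {n : ℕ} {U : Set (Fin n → ℂ)}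

/-- If `∂_j ^ K F` vanishes on `U`, then `F` is polynomial along lines in the direction `j`. -/
theorem exists_polynomial_of_iterate_partialDeriv_eq_zero (hUo : IsOpen U) {j : Fin n}
    {x₀ : Fin n → ℂ} {r : ℝ} (hr : ∀ w ∈ Metric.ball (0 : ℂ) r, x₀ + Pi.single j w ∈ U)
    {F : (Fin n → ℂ) → ℂ} (hF : ContDiffOn ℂ ∞ F U) {K : ℕ}
    (hK : Set.EqOn ((partialDeriv j)^[K] F) 0 U) :
    ∃ q : ℂ[X], ∀ w ∈ Metric.ball (0 : ℂ) r, F (x₀ + Pi.single j w) = q.eval w := by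
  induction K generalizing F with
  | zero => exact ⟨0, fun w hw => by simpa using hK (hr w hw)⟩
  | succ K ih =>
    obtain ⟨q, hq⟩ := ih (contDiffOn_partialDeriv hUo hF j) hK
    obtain ⟨Q, hQ⟩ := exists_derivative_eq q
    have hd : ∀ w ∈ Metric.ball (0 : ℂ) r,
        HasDerivAt (fun w => F (x₀ + Pi.single j w) - Q.eval w) 0 w := by
      intro w hw
      have hFd : HasFDerivAt F (fderiv ℂ F (x₀ + Pi.single j w)) (x₀ + Pi.single j w) :=
        ((hF.differentiableOn (by simp)).differentiableAt
          (hUo.mem_nhds (hr w hw))).hasFDerivAt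
      have hl : HasDerivAt (fun w : ℂ => x₀ + Pi.single j w) (Pi.single j 1) w :=
        (hasDerivAt_single j w).const_add x₀
      have h1 := hFd.comp_hasDerivAt w hl
      have h2 := h1.sub (Q.hasDerivAt w)
      have h3 : fderiv ℂ F (x₀ + Pi.single j w) (Pi.single j 1) = q.eval w := hq w hw
      rw [hQ, h3, sub_self] at h2
      exact h2
    rcases Set.eq_empty_or_nonempty (Metric.ball (0 : ℂ) r) with he | ⟨w₀, hw₀⟩
    · exact ⟨0, fun w hw => by simp [he] at hw⟩
    refine ⟨Q + C (F (x₀ + Pi.single j w₀) - Q.eval w₀), fun w hw => ?_⟩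
    have := Metric.isOpen_ball.is_const_of_deriv_eq_zero
      (convex_ball (0 : ℂ) r).isPreconnected
      (fun w hw => (hd w hw).differentiableAt.differentiableWithinAt)
      (fun w hw => (hd w hw).deriv) hw hw₀
    rw [eval_add, eval_C, ← this]
    ring

variable {m : ℕ} {a : Fin (m + 2) → ℕ}

theorem eval_genericPoly_add_single (ha0 : a 0 = 0) (x₀ : Fin (m + 2) → ℂ) (w t : ℂ) :
    (genericPoly a (x₀ + Pi.single 0 w)).eval t = (genericPoly a x₀).eval t + w := by
  simp [eval_genericPoly, add_mul, Finset.sum_add_distrib, Pi.single_apply, ha0]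

/-- Weighted power sums of all roots of `f(x; t)` can be polynomials in the constant coefficient
only if all the weights are equal. -/
theorem weights_eq_of_powerSums_eq (ha : StrictMono a) (ha0 : a 0 = 0) {x₀ : Fin (m + 2) → ℂ}
    (hx₀ : x₀ ∉ singularLocus a) {V : Set ℂ} (hV : V.Infinite) {ι : Type*} [Fintype ι]
    {R : ι → ℂ → ℂ} (hR : ∀ i, ∀ w ∈ V, (genericPoly a (x₀ + Pi.single 0 w)).eval (R i w) = 0)
    (hinj : ∀ w ∈ V, Function.Injective fun i => R i w) (c : ι → ℂ) {C₀ : ℕ} {q : ℕ → ℂ[X]}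
    (hq : ∀ p < a (Fin.last (m + 1)), ∀ w ∈ V, ∑ i, c i * R i w ^ (C₀ + p) = (q p).eval w)
    (i i' : ι) : c i = c i' := by
  classical
  set f := genericPoly a x₀ with hf
  -- With Q(z, y) = (f(z) - f(y))/(z - y), this is Σ_k c_k R_k^{C₀} Q(z, R_k) expanded in powers of
  -- R_k: each power sum is replaced by its polynomial in w, and w by -f(z). Powers of y in Q stay
  -- below d, so d power sums suffice.
  let H : ℂ[X] := ∑ j, C (x₀ j) * ∑ k ∈ Finset.range (a j), X ^ k * (q (a j - 1 - k)).comp (-f)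
  let D : ℂ[X] := X ^ C₀ * derivative f
  have hw : ∀ i, ∀ w ∈ V, f.eval (R i w) = -w := by
    intro i w hw
    have := hR i w hw
    rw [eval_genericPoly_add_single ha0] at this
    exact eq_neg_of_add_eq_zero_left this
  have hD : D ≠ 0 := by
    refine mul_ne_zero (pow_ne_zero _ X_ne_zero) fun h => ?_
    have : f.natDegree = 0 := derivative_eq_zero.1 h
    simp only [singularLocus, Set.mem_ofPred_eq, not_or] at hx₀
    rw [natDegree_genericPoly ha hx₀.2.1] at this
    exact (last_pos ha).ne' this
  let Q : ℂ → ℂ → ℂ := fun z y =>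
    ∑ j, x₀ j * ∑ k ∈ Finset.range (a j), z ^ k * y ^ (a j - 1 - k)
  have hQ : ∀ z y, Q z y * (z - y) = f.eval z - f.eval y := by
    intro z y
    simp only [Q, hf, eval_genericPoly, ← Finset.sum_sub_distrib, ← mul_sub, ← geom_sum₂_mul]
    rw [Finset.sum_mul]
    exact Finset.sum_congr rfl fun j _ => mul_assoc _ _ _
  have hQd : ∀ z, Q z z = (derivative f).eval z := by
    intro z
    simp only [Q, hf, eval_derivative_genericPoly, geom_sum₂_self]
  have key : ∀ i, H = C (c i) * D := by
    intro i
    -- Since f(R_i(w)) = -w, the map R_i is injective and its values on V form an infinite set. At z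
    -- = R_i(w) the divided difference vanishes against every other root and equals f'(z) against
    -- R_i, so the value is c_i z^{C₀} f'(z).
    refine eq_of_infinite_eval_eq _ _ ((hV.image (f := R i) ?_).mono ?_)
    · intro w h w' h' e
      have := hw i w h
      rw [show R i w = R i w' from e, hw i w' h'] at this
      exact (neg_injective this).symm
    · rintro z ⟨w, hwV, rfl⟩
      have h1 : ∑ k, c k * R k w ^ C₀ * Q (R i w) (R k w) =
          c i * R i w ^ C₀ * (derivative f).eval (R i w) := by
        rw [Finset.sum_eq_single i, hQd]
        · intro k _ hk
          have h2 := hQ (R i w) (R k w)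
          rw [hw i w hwV, hw k w hwV, sub_self, mul_eq_zero] at h2
          rw [h2.resolve_right (sub_ne_zero.2 fun h => hk (hinj w hwV h).symm), mul_zero]
        · simp
      have h3 : H.eval (R i w) = ∑ k, c k * R k w ^ C₀ * Q (R i w) (R k w) := by
        simp only [H, Q, eval_finsetSum, eval_mul, eval_C, eval_pow, eval_X, eval_comp, eval_neg,
          hw i w hwV, neg_neg, Finset.mul_sum]
        rw [Finset.sum_comm]
        refine Finset.sum_congr rfl fun j _ => ?_
        rw [Finset.sum_comm]
        refine Finset.sum_congr rfl fun k hk => ?_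
        have hlt : a j - 1 - k < a (Fin.last (m + 1)) := by
          have := ha.monotone (Fin.le_last j)
          have := Finset.mem_range.1 hk
          omega
        rw [← hq _ hlt w hwV, Finset.mul_sum, Finset.mul_sum]
        refine Finset.sum_congr rfl fun l _ => ?_
        rw [pow_add]
        ring
      change H.eval (R i w) = (C (c i) * D).eval (R i w)
      rw [h3, h1]
      simp [D, mul_assoc]
  have := (key i).symm.trans (key i')
  exact C_injective (mul_right_cancel₀ hD this)

end Line

/-! ### Linear combinations of ladders and propagation of zeros -/

section Independence

variable {n : ℕ} {a : Fin n → ℕ} {U : Set (Fin n → ℂ)}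

theorem IsLadder.sum {ι : Type*} [Fintype ι] {T : ι → ℤ → ℤ → (Fin n → ℂ) → ℂ} (hUo : IsOpen U)
    (hT : ∀ i, IsLadder a U (T i)) (c : ι → ℂ) :
    IsLadder a U fun k s x => ∑ i, c i * T i k s x where
  contDiffOn k s := ContDiffOn.sum fun i _ => contDiffOn_const.mul ((hT i).contDiffOn k s)
  partialDeriv k s j x hx := by
    have hd : HasFDerivAt (fun x => ∑ i, c i * T i k s x)
        (∑ i, c i • fderiv ℂ (T i k s) x) x := by
      refine HasFDerivAt.fun_sum fun i _ => ?_
      exact ((((hT i).contDiffOn k s).differentiableOn (by simp)).differentiableAt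
        (hUo.mem_nhds hx)).hasFDerivAt.const_mul (c i)
    rw [MonomialCurve.partialDeriv, hd.fderiv, sum_apply]
    refine Finset.sum_congr rfl fun i _ => ?_
    rw [smul_apply, smul_eq_mul, ← (hT i).partialDeriv k s j hx]
    rfl

theorem partialDeriv_zero (j : Fin n) : partialDeriv j (0 : (Fin n → ℂ) → ℂ) = 0 := by
  ext x
  have : (0 : (Fin n → ℂ) → ℂ) = fun _ => 0 := rfl
  simp [partialDeriv, this]

theorem monomialDeriv_zero (u : Fin n → ℕ) : monomialDeriv u (0 : (Fin n → ℂ) → ℂ) = 0 := by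
  unfold monomialDeriv
  induction List.finRange n with
  | nil => rfl
  | cons j t ih =>
    rw [List.foldr_cons, ih]
    exact Function.iterate_fixed (partialDeriv_zero j) _

theorem IsLadder.eqOn_zero {T : ℤ → ℤ → (Fin n → ℂ) → ℂ} (hT : IsLadder a U T) (hUo : IsOpen U)
    {k s : ℤ} (h : Set.EqOn (T k s) 0 U) (u : Fin n → ℕ) :
    Set.EqOn (T (k - ∑ j, (u j : ℤ)) (s - ∑ j, (a j * u j : ℤ))) 0 U := by
  refine (hT.monomialDeriv hUo k s u).symm.trans ((eqOn_monomialDeriv hUo h u).trans ?_)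
  rw [monomialDeriv_zero]
  exact Set.eqOn_refl _ _

end Independence

/-! ### Linear independence and assembly -/

section Main

variable {m : ℕ} {a : Fin (m + 2) → ℕ} {U : Set (Fin (m + 2) → ℂ)}

theorem isRootPair (ha : StrictMono a) (ha0 : a 0 = 0) (hUo : IsOpen U)
    (hUS : U ⊆ (singularLocus a)ᶜ) {ρ ρ' l : U → ℂ} (hρ : ρ ∈ rootsOn a U)
    (hρ' : ρ' ∈ rootsOn a U) (hl : IsLogBranch l fun x => ρ x / ρ' x) :
    IsRootPair a U (zeroExt ρ) (zeroExt ρ') (zeroExt l) where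
  strictMono := ha
  zero := ha0
  isOpen := hUo
  subset := hUS
  diff_fst := hρ.1
  diff_snd := hρ'.1
  diff_log := hl.1
  root_fst x hx := by
    rw [zeroExt_coe ρ ⟨x, hx⟩]
    exact hρ.2 ⟨x, hx⟩
  root_snd x hx := by
    rw [zeroExt_coe ρ' ⟨x, hx⟩]
    exact hρ'.2 ⟨x, hx⟩
  exp_log x hx := by
    rw [zeroExt_coe ρ ⟨x, hx⟩, zeroExt_coe ρ' ⟨x, hx⟩, zeroExt_coe l ⟨x, hx⟩]
    exact hl.2 ⟨x, hx⟩

theorem exists_isLogBranch_div (ha : StrictMono a) (ha0 : a 0 = 0) (hUo : IsOpen U)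
    (hUc : IsSimplyConnected U) (hUS : U ⊆ (singularLocus a)ᶜ) {ρ ρ' : U → ℂ}
    (hρ : ρ ∈ rootsOn a U) (hρ' : ρ' ∈ rootsOn a U) :
    ∃ l : U → ℂ, IsLogBranch l fun x => ρ x / ρ' x := by
  have h0 : ∀ {σ : U → ℂ}, σ ∈ rootsOn a U → ∀ x, σ x ≠ 0 := fun hσ x =>
    root_ne_zero ha (hUS x.2) ha0 (hσ.2 x)
  refine exists_isLogBranch hUo hUc ?_ fun x => div_ne_zero (h0 hρ x) (h0 hρ' x)
  have hd : DifferentiableOn ℂ (fun x => zeroExt ρ x / zeroExt ρ' x) U := by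
    simp only [div_eq_mul_inv]
    refine DifferentiableOn.fun_mul hρ.1 (DifferentiableOn.fun_inv hρ'.1 fun x hx => ?_)
    rw [zeroExt_coe ρ' ⟨x, hx⟩]
    exact h0 hρ' _
  refine hd.congr fun x hx => ?_
  rw [zeroExt_coe ρ ⟨x, hx⟩, zeroExt_coe ρ' ⟨x, hx⟩]
  exact zeroExt_coe (fun x => ρ x / ρ' x) ⟨x, hx⟩

theorem apply_curveMatrix_zero {n : ℕ} (a : Fin n → ℕ) (u : Fin n → ℕ) :
    apply (curveMatrix a) u 0 = ∑ j, (u j : ℤ) := by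
  simp [apply, curveMatrix, Matrix.mulVec, dotProduct]

theorem apply_curveMatrix_one {n : ℕ} (a : Fin n → ℕ) (u : Fin n → ℕ) :
    apply (curveMatrix a) u 1 = ∑ j, (a j * u j : ℤ) := by
  simp [apply, curveMatrix, Matrix.mulVec, dotProduct]

/-- If a member of exponent `(0, 0)` of a ladder vanishes, then the members of exponents `(0, -s)`
are polynomial in the constant coefficient, for consecutive values of `s`. -/
theorem IsLadder.exists_polynomial {T : ℤ → ℤ → (Fin (m + 2) → ℂ) → ℂ} (hT : IsLadder a U T)
    (hUo : IsOpen U) (ha0 : a 0 = 0) (hgcd : Finset.univ.gcd a = 1)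
    (h00 : Set.EqOn (T 0 0) 0 U) (d : ℕ) {x₀ : Fin (m + 2) → ℂ} {r : ℝ}
    (hball : ∀ w ∈ Metric.ball (0 : ℂ) r, x₀ + Pi.single 0 w ∈ U) :
    ∃ C₀ : ℕ, 0 < C₀ ∧ ∃ q : ℕ → ℂ[X], ∀ p < d, ∀ w ∈ Metric.ball (0 : ℂ) r,
      T 0 (-((C₀ + p : ℕ) : ℤ)) (x₀ + Pi.single 0 w) = (q p).eval w := by
  obtain ⟨C₀, K, hC, hlev⟩ := exists_level_of_gcd_eq_one ha0 hgcd d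
  refine ⟨C₀, hC, ?_⟩
  have hpoly : ∀ p : ℕ, ∃ q : ℂ[X], p < d → ∀ w ∈ Metric.ball (0 : ℂ) r,
      T 0 (-((C₀ + p : ℕ) : ℤ)) (x₀ + Pi.single 0 w) = q.eval w := by
    intro p
    by_cases hp : p < d
    · obtain ⟨u, hu0, hu1⟩ := hlev p hp
      -- The member of exponent (-(K + 1), -(C₀ + p)) is reached in two ways: from (0, 0) by D_u,
      -- which shows that it vanishes, and from (0, -(C₀ + p)) by K + 1 applications of ∂_0.
      have hK : Set.EqOn ((MonomialCurve.partialDeriv 0)^[K + 1] (T 0 (-((C₀ + p : ℕ) : ℤ)))) 0 U := by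
        refine (hT.iterate_partialDeriv hUo _ _ 0 (K + 1)).trans ?_
        have := hT.eqOn_zero hUo h00 u
        have e0 : ∑ j, (u j : ℤ) = ((K + 1 : ℕ) : ℤ) := by exact_mod_cast hu0
        have e1 : ∑ j, (a j * u j : ℤ) = ((C₀ + p : ℕ) : ℤ) := by exact_mod_cast hu1
        rw [e0, e1] at this
        simpa only [ha0, Nat.cast_zero, zero_mul, sub_zero, zero_sub] using this
      obtain ⟨q, hq⟩ := exists_polynomial_of_iterate_partialDeriv_eq_zero hUo hball
        (hT.contDiffOn 0 (-((C₀ + p : ℕ) : ℤ))) hK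
      exact ⟨q, fun _ => hq⟩
    · exact ⟨0, fun h => absurd h hp⟩
  choose q hq using hpoly
  exact ⟨q, hq⟩

theorem exists_ball_line_subset {n : ℕ} {U : Set (Fin n → ℂ)} (hUo : IsOpen U) {x₀ : Fin n → ℂ}
    (hx₀ : x₀ ∈ U) (j : Fin n) :
    ∃ r > 0, ∀ w ∈ Metric.ball (0 : ℂ) r, x₀ + Pi.single j w ∈ U := by
  have hcont : Continuous fun w : ℂ => x₀ + Pi.single j w :=
    continuous_const.add (continuous_pi fun i => by
      by_cases hi : i = j
      · subst hi
        simpa using continuous_id'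
      · simpa [hi] using continuous_const)
  have := (hUo.preimage hcont).mem_nhds (x := 0) (by simpa using hx₀)
  obtain ⟨r, hr, h⟩ := Metric.mem_nhds_iff.1 this
  exact ⟨r, hr, fun w hw => h hw⟩

/-- Weights attached to the roots different from `ρ'`, with total weight zero over all roots. -/
theorem sum_weights_mul {ι : Type*} [Fintype ι] [DecidableEq ι] (i₀ : ι) (g : {i // i ≠ i₀} → ℂ)
    (φ : ι → ℂ) :
    ∑ i, (if h : i = i₀ then -∑ k, g k else g ⟨i, h⟩) * φ i = ∑ k, g k * (φ k.1 - φ i₀) := by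
  rw [Fintype.sum_eq_add_sum_subtype_ne _ i₀, dif_pos rfl]
  have e2 : ∀ k : {i // i ≠ i₀}, (if h : (k : ι) = i₀ then -∑ k, g k else g ⟨k, h⟩) = g k :=
    fun k => dif_neg k.2
  simp only [e2, mul_sub, Finset.sum_sub_distrib, ← Finset.sum_mul]
  ring

/-- Weighted power sums of the roots of `f(x; t)` on `U`, with total weight zero, can be polynomial
in the constant coefficient only if all the weights vanish. -/
theorem weights_eq_zero_of_powerSums_eq (ha : StrictMono a) (ha0 : a 0 = 0)
    (hUS : U ⊆ (singularLocus a)ᶜ) (hUc : IsPreconnected U) [Fintype (rootsOn a U)]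
    {c : rootsOn a U → ℂ} (hsum : ∑ σ, c σ = 0) {x₀ : Fin (m + 2) → ℂ} (hx₀ : x₀ ∈ U) {r : ℝ}
    (hr : 0 < r) (hball : ∀ w ∈ Metric.ball (0 : ℂ) r, x₀ + Pi.single 0 w ∈ U) {C₀ : ℕ}
    {q : ℕ → ℂ[X]} (hq : ∀ p < a (Fin.last (m + 1)), ∀ w ∈ Metric.ball (0 : ℂ) r,
      ∑ σ : rootsOn a U, c σ * zeroExt σ.1 (x₀ + Pi.single 0 w) ^ (C₀ + p) = (q p).eval w)
    (σ : rootsOn a U) : c σ = 0 := by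
  let R : rootsOn a U → ℂ → ℂ := fun σ w => zeroExt σ.1 (x₀ + Pi.single 0 w)
  have hRU : ∀ (σ : rootsOn a U) (w : ℂ) (hw : w ∈ Metric.ball (0 : ℂ) r),
      R σ w = σ.1 ⟨_, hball w hw⟩ := fun σ w hw => zeroExt_coe σ.1 ⟨_, hball w hw⟩
  have hV : (Metric.ball (0 : ℂ) r).Infinite :=
    infinite_of_mem_nhds (0 : ℂ) (Metric.ball_mem_nhds 0 hr)
  have hR : ∀ σ, ∀ w ∈ Metric.ball (0 : ℂ) r,
      (genericPoly a (x₀ + Pi.single 0 w)).eval (R σ w) = 0 := by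
    intro σ w hw
    rw [hRU σ w hw]
    exact σ.2.2 ⟨_, hball w hw⟩
  have hinj : ∀ w ∈ Metric.ball (0 : ℂ) r, Function.Injective fun σ => R σ w := by
    intro w hw σ τ h
    dsimp only at h
    rw [hRU σ w hw, hRU τ w hw] at h
    exact Subtype.ext (eq_of_mem_rootsOn ha hUS hUc σ.2 τ.2 h)
  have hconst : ∀ τ, c τ = c σ := fun τ =>
    weights_eq_of_powerSums_eq ha ha0 (hUS hx₀) hV hR hinj c hq τ σ
  rw [Finset.sum_congr rfl fun τ _ => hconst τ, Finset.sum_const, nsmul_eq_mul,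
    mul_eq_zero] at hsum
  refine hsum.resolve_left ?_
  rw [Finset.card_univ]
  exact_mod_cast (Fintype.card_pos_iff.2 ⟨σ⟩).ne'

/-- A relation among the solutions propagates along the combined ladder to exponent (0, 0), and from
there yields polynomial weighted power sums of the roots, which force the weights to vanish. -/
theorem linearIndependent_solutionFamily (ha : StrictMono a) (ha0 : a 0 = 0)
    (hgcd : Finset.univ.gcd a = 1) (hUo : IsOpen U) (hUc : IsSimplyConnected U)
    (hUS : U ⊆ (singularLocus a)ᶜ) {α : Fin 2 → ℤ} (hα : α ∈ semigroupSet (curveMatrix a))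
    [Finite (rootsOn a U)] (ρ' : rootsOn a U) (l : {ρ : rootsOn a U // ρ ≠ ρ'} → U → ℂ)
    (hl : ∀ ρ, IsLogBranch (l ρ) fun x => ρ.1.1 x / ρ'.1 x) :
    LinearIndependent ℂ (solutionFamily a α ρ' l) := by
  classical
  have : Fintype (rootsOn a U) := Fintype.ofFinite _
  have hpair : ∀ ρ : {ρ : rootsOn a U // ρ ≠ ρ'},
      IsRootPair a U (zeroExt ρ.1.1) (zeroExt ρ'.1) (zeroExt (l ρ)) := fun ρ =>
    isRootPair ha ha0 hUo hUS ρ.1.2 ρ'.2 (hl ρ)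
  obtain ⟨w, hw⟩ := hα
  have hα0 : α 0 = ∑ j, (w j : ℤ) := by rw [← hw, apply_curveMatrix_zero]
  have hα1 : α 1 = ∑ j, (a j * w j : ℤ) := by rw [← hw, apply_curveMatrix_one]
  obtain ⟨k, hk⟩ : ∃ k : ℕ, α 0 = k := Int.eq_ofNat_of_zero_le (by rw [hα0]; positivity)
  have hα' : α = ![α 0, α 1] := by
    ext i
    fin_cases i <;> rfl
  let T : Option {ρ : rootsOn a U // ρ ≠ ρ'} → ℤ → ℤ → (Fin (m + 2) → ℂ) → ℂ := fun o =>
    match o with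
    | none => fun k s => hyperPoly (curveMatrix a) ![k, s]
    | some ρ => tauLadder a (zeroExt ρ.1.1) (zeroExt ρ'.1) (zeroExt (l ρ))
  have hT : ∀ o, IsLadder a U (T o) := by
    rintro (_ | ρ)
    · exact isLadder_hyperPoly a U
    · exact (hpair ρ).isLadder_tauLadder
  have hTsol : ∀ o (x : U), solutionFamily a α ρ' l o x = T o (α 0) (α 1) x := by
    rintro (_ | ρ) x
    · change hyperPoly (curveMatrix a) α x = hyperPoly (curveMatrix a) ![α 0, α 1] x
      rw [← hα']
    · change tau a α ρ.1.1 ρ'.1 (l ρ) x =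
        tauLadder a (zeroExt ρ.1.1) (zeroExt ρ'.1) (zeroExt (l ρ)) (α 0) (α 1) x
      rw [tau_eq_tauSum ha hk, hk]
      rfl
  rw [Fintype.linearIndependent_iff]
  intro g hg
  have hS := IsLadder.sum hUo hT g
  have hzero : Set.EqOn (fun x => ∑ o, g o * T o (α 0) (α 1) x) 0 U := by
    intro x hx
    have := congrFun hg ⟨x, hx⟩
    simp only [Finset.sum_apply, Pi.smul_apply, smul_eq_mul, hTsol, Pi.zero_apply] at this
    exact this
  -- Here α ∈ I(A) is used: D_w with A·w = α carries exponent α to (0, 0).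
  have h00 : Set.EqOn (fun x => ∑ o, g o * T o 0 0 x) 0 U := by
    have := hS.eqOn_zero hUo hzero w
    simpa only [← hα0, ← hα1, sub_self] using this
  obtain ⟨x₀, hx₀⟩ := hUc.nonempty
  obtain ⟨r, hr, hball⟩ := exists_ball_line_subset hUo hx₀ 0
  obtain ⟨C₀, hC, q, hq⟩ :=
    hS.exists_polynomial hUo ha0 hgcd h00 (a (Fin.last (m + 1))) hball
  -- Giving ρ' minus the sum of the other coefficients rewrites a combination of differences σ^N -
  -- ρ'^N as a power sum over all roots with total weight zero.
  let c : rootsOn a U → ℂ := fun σ =>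
    if h : σ = ρ' then -∑ ρ, g (some ρ) else g (some ⟨σ, h⟩)
  have hc : ∀ φ : rootsOn a U → ℂ, ∑ σ, c σ * φ σ = ∑ ρ, g (some ρ) * (φ ρ.1 - φ ρ') :=
    sum_weights_mul ρ' fun ρ => g (some ρ)
  have hsum : ∑ σ, c σ = 0 := by simpa using hc fun _ => 1
  have hpow : ∀ p < a (Fin.last (m + 1)), ∀ w ∈ Metric.ball (0 : ℂ) r,
      ∑ σ : rootsOn a U, c σ * zeroExt σ.1 (x₀ + Pi.single 0 w) ^ (C₀ + p) =
        (C ((C₀ + p : ℕ) : ℂ) * q p).eval w := by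
    intro p hp w hw
    have hne : ((C₀ + p : ℕ) : ℂ) ≠ 0 := by exact_mod_cast (by omega : C₀ + p ≠ 0)
    have hne' : -(-((C₀ + p : ℕ) : ℤ)) ≠ 0 := by omega
    -- At level 0 only u = 0 could contribute, and its second coordinate 0 differs from -(C₀ + p)
    -- because C₀ > 0.
    have hnone : T none 0 (-((C₀ + p : ℕ) : ℤ)) (x₀ + Pi.single 0 w) = 0 := by
      have := hyperPoly_natCast a 0 (-((C₀ + p : ℕ) : ℤ)) (x₀ + Pi.single 0 w)
      rw [hyperSum_zero, if_neg (by push_cast; omega)] at this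
      exact this
    have hsome : ∀ ρ, T (some ρ) 0 (-((C₀ + p : ℕ) : ℤ)) (x₀ + Pi.single 0 w) =
        (zeroExt ρ.1.1 (x₀ + Pi.single 0 w) ^ (C₀ + p) -
          zeroExt ρ'.1 (x₀ + Pi.single 0 w) ^ (C₀ + p)) / ((C₀ + p : ℕ) : ℂ) := by
      intro ρ
      change tauSum a _ _ _ 0 _ _ = _
      rw [tauSum_zero, powDiff, if_neg hne', neg_neg, zpow_natCast, zpow_natCast, Int.cast_natCast]
    refine (hc _).trans ?_
    rw [eval_mul, eval_C,
      ← hq p hp w hw, Fintype.sum_option, hnone, mul_zero, zero_add, Finset.mul_sum]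
    refine Finset.sum_congr rfl fun ρ _ => ?_
    rw [hsome]
    field_simp
  have hc0 : ∀ σ, c σ = 0 := weights_eq_zero_of_powerSums_eq ha ha0 hUS
    hUc.isPathConnected.isConnected.isPreconnected hsum hx₀ hr hball
    (q := fun p => C ((C₀ + p : ℕ) : ℂ) * q p) hpow
  have hg0 : ∀ ρ, g (some ρ) = 0 := fun ρ => by
    have := hc0 ρ.1
    simpa [c, ρ.2] using this
  rintro (_ | ρ)
  -- With all the other coefficients zero, the relation at exponent (0, 0) reads g(none) · 1 = 0.
  · have h1 : T none 0 0 x₀ = 1 := by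
      have := hyperPoly_natCast a 0 0 x₀
      rw [hyperSum_zero, if_pos Nat.cast_zero] at this
      exact this
    have := h00 hx₀
    simpa [Fintype.sum_option, hg0, h1] using this
  · exact hg0 ρ

end Main

end MonomialCurve

theorem theorem3p1 {m : ℕ} (hm : 1 ≤ m) (a : Fin (m + 2) → ℕ) (ha : StrictMono a)
    (ha0 : a 0 = 0) (hgcd : Finset.univ.gcd a = 1)
    (U : Set (Fin (m + 2) → ℂ)) (hUo : IsOpen U) (hUc : IsSimplyConnected U)
    (hUS : U ⊆ (MonomialCurve.singularLocus a)ᶜ)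
    (α : Fin 2 → ℤ)
    (hα : α ∈ MonomialCurve.semigroupSet (MonomialCurve.curveMatrix a)) :
    (MonomialCurve.rootsOn a U).ncard = a (Fin.last (m + 1)) ∧
    ∀ ρ' : MonomialCurve.rootsOn a U,
      (∀ ρ : MonomialCurve.rootsOn a U,
        ∃ l : U → ℂ, MonomialCurve.IsLogBranch l (fun x => ρ.1 x / ρ'.1 x)) ∧
      ∀ l : {ρ : MonomialCurve.rootsOn a U // ρ ≠ ρ'} → U → ℂ,
        (∀ ρ, MonomialCurve.IsLogBranch (l ρ) (fun x => ρ.1.1 x / ρ'.1 x)) →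
        (∀ o, MonomialCurve.IsHypergeometric (MonomialCurve.curveMatrix a) α
          (MonomialCurve.solutionFamily a α ρ' l o)) ∧
        LinearIndependent ℂ (MonomialCurve.solutionFamily a α ρ' l) ∧
        Nat.card (Option {ρ : MonomialCurve.rootsOn a U // ρ ≠ ρ'}) = a (Fin.last (m + 1)) := by
  classical
  have hcard := MonomialCurve.ncard_rootsOn ha hUo hUS hUc
  have hfin : Finite (MonomialCurve.rootsOn a U) :=
    Set.finite_of_ncard_pos (by rw [hcard]; exact MonomialCurve.last_pos ha)
  have hα0 : 0 ≤ α 0 := by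
    obtain ⟨w, rfl⟩ := hα
    rw [MonomialCurve.apply_curveMatrix_zero]
    positivity
  refine ⟨hcard, fun ρ' => ⟨fun ρ =>
    MonomialCurve.exists_isLogBranch_div ha ha0 hUo hUc hUS ρ.2 ρ'.2, fun l hl => ⟨?_, ?_, ?_⟩⟩⟩
  · rintro (_ | ρ)
    · exact MonomialCurve.isHypergeometric_hyperPoly hUo hα0
    · exact MonomialCurve.isHypergeometric_tau hα0
        (MonomialCurve.isRootPair ha ha0 hUo hUS ρ.1.2 ρ'.2 (hl ρ))
  · exact MonomialCurve.linearIndependent_solutionFamily ha ha0 hgcd hUo hUc hUS hα ρ' l hl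
  · rw [← hcard, ← Nat.card_coe_set_eq, Finite.card_option]
    have : Fintype (MonomialCurve.rootsOn a U) := Fintype.ofFinite _
    rw [Nat.card_eq_fintype_card, Nat.card_eq_fintype_card, Fintype.card_subtype_compl,
      Fintype.card_subtype_eq]
    have : 0 < Fintype.card (MonomialCurve.rootsOn a U) := Fintype.card_pos_iff.2 ⟨ρ'⟩
    omega
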